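/- Let $d$ be a prime, $\mathcal X=\mathbb F_d\times\mathbb F_d$ (as an additive group), $\omega\in\mathbb C$ a primitive $d$th root of unity, and let $X|i\rangle=|i-1 \bmod d\rangle$, $Z|j\rangle=\omega^j|j\rangle$ on $\mathbb C^d$, $E_{(i,j)}=X^iZ^j$. Let $\mathcal W=(A_u)_{u\in\mathcal X}$, $A_u=\sum_{v\in\mathcal X}a_{uv}E_v$, be a quantum discrete memoryless channel, with $W(v)=\sum_u|a_{uv}|^2$ and $\sum_vW(v)=1$. It acts on operators on $H_n=(\mathbb C^d)^{\otimes n}$ by $\Phi_n(S)=\sum_{u\in\mathcal X^n}A_uSA_u^*$, where $A_u=A_{u_1}\otimes\cdots\otimes A_{u_n}$. For a subspace $0\ne\mathcal Q\subseteq H_n$ (a code) of dimension $K$ and a completely positive trace-preserving map $\mathcal R$ on the operators on $H_n$ put \[ R(\mathcal Q)=\frac{\log_d K}{n},\qquad F(\mathcal Q,\mathcal R)=\frac1K\min_{B}\sum_{\psi\in B}\langle\psi|\,\mathcal R\Phi_n\big(|\psi\rangle\langle\psi|\big)\,|\psi\rangle , \] the minimum being over all orthonormal bases $B$ of $\mathcal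 Q$. Let \[ E(R,\mathcal W)=\liminf_{n\to\infty}\ \sup_{\mathcal Q,\mathcal R:\ R(\mathcal Q)\ge R}\ -\frac1n\log_d\big(1-F(\mathcal Q,\mathcal R)\big) \] be the reliability of the channel at rate $R$, where $-\log_d(1-F)=+\infty$ if $F\ge 1$ (for a trace-preserving $\Phi_n$ always $F\le1$). For $x\in\mathcal X$ put $|x|_W=-\log_d\sum_{e\in\mathcal X}\sqrt{W(e)W(e-x)}\in[0,+\infty]$, and for a probability distribution $P$ on $\mathcal X$ let $H(P)=-\sum_xP(x)\log_dP(x)$. Then for every rate $0\le R\le1$ \[ E(R,\mathcal W)\ \ge\ E_x(R,\mathcal W)=\min_{P:\,H(P)\ge 1-R}\Big[\sum_{x\in\mathcal X}P(x)|x|_W-(R+H(P)-1)\Big], \] where $P$ runs over the probability distributions on $\mathcal X$, $0\cdot\infty=0$, the minimum is attained, and the values lie in $(-\infty,+\infty]$. -/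

import Mathlib

noncomputable section

namespace QuantumChannel

/-- The alphabet `𝒳`, of size `q = d²`. Only the additive group of the field with `d²` elements
is used, and its elements are written as pairs of elements of the field with `d` elements. -/
abbrev Alphabet (d : ℕ) : Type := ZMod d × ZMod d

/-- The `n`-fold tensor power of `ℂ^d`, in the coordinates of its standard product basis
`|i₁ … iₙ⟩`, `i ∈ (ℤ/d)ⁿ`, with the Hilbert space norm. -/
abbrev QuditSpace (d n : ℕ) [NeZero d] : Type := EuclideanSpace ℂ (Fin n → ZMod d)

/-- The operators on the `n`-qudit space. -/
abbrev Op (d n : ℕ) [NeZero d] : Type := QuditSpace d n →L[ℂ] QuditSpace d n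

/-- The shift `X |i⟩ = |i - 1 mod d⟩`. -/
def shiftX (d : ℕ) [NeZero d] : Matrix (ZMod d) (ZMod d) ℂ :=
  Matrix.of fun r c => if r = c - 1 then 1 else 0

/-- The phase operator `Z |j⟩ = ω ^ j |j⟩`. -/
def phaseZ (d : ℕ) [NeZero d] (ω : ℂ) : Matrix (ZMod d) (ZMod d) ℂ :=
  Matrix.diagonal fun j => ω ^ j.val

/-- The error basis `E_{i,j} = X ^ i Z ^ j`. -/
def errorOp (d : ℕ) [NeZero d] (ω : ℂ) (v : Alphabet d) : Matrix (ZMod d) (ZMod d) ℂ :=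
  shiftX d ^ v.1.val * phaseZ d ω ^ v.2.val

/-- A quantum discrete memoryless channel: the operators `A_u = ∑ v, a u v • E_v`, `u ∈ 𝒳`, given
by their coefficients in the error basis. The numbers `W v = ∑ u, |a u v|²` are required to be a
probability distribution; this holds whenever `∑ u, A_uᴴ A_u = 1`, that is, whenever the channel
preserves traces. -/
structure QDMC (d : ℕ) [NeZero d] where
  /-- The coefficients of the operators. -/
  a : Alphabet d → Alphabet d → ℂ
  sum_normSq : ∑ v, ∑ u, ‖a u v‖ ^ 2 = 1

namespace QDMC

variable {d : ℕ} [NeZero d]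

/-- The probability distribution `W` on the alphabet. -/
def W (𝒲 : QDMC d) (v : Alphabet d) : ℝ := ∑ u, ‖𝒲.a u v‖ ^ 2

/-- The one-qudit operator `A_u`. -/
def kraus (𝒲 : QDMC d) (ω : ℂ) (u : Alphabet d) : Matrix (ZMod d) (ZMod d) ℂ :=
  ∑ v, 𝒲.a u v • errorOp d ω v

/-- The operator `A_{u₁} ⊗ ⋯ ⊗ A_{uₙ}` on the `n`-qudit space. -/
def krausN (𝒲 : QDMC d) (ω : ℂ) {n : ℕ} (u : Fin n → Alphabet d) : Op d n :=
  Matrix.toEuclideanCLM (n := Fin n → ZMod d) (𝕜 := ℂ)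
    (Matrix.of fun r c => ∏ i, 𝒲.kraus ω (u i) (r i) (c i))

/-- The `n`-fold memoryless channel `S ↦ ∑ u, A_u S A_u^*`, where `A_u` runs over the tensor
products `A_{u₁} ⊗ ⋯ ⊗ A_{uₙ}`. -/
def apply (𝒲 : QDMC d) (ω : ℂ) (n : ℕ) (S : Op d n) : Op d n :=
  ∑ u : Fin n → Alphabet d,
    𝒲.krausN ω u * S * ContinuousLinearMap.adjoint (𝒲.krausN ω u)

end QDMC

variable {d : ℕ} [NeZero d]

/-- The rate `(log_d K) / n` of a code of dimension `K` in the `n`-qudit space. -/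
def rate {n : ℕ} (Q : Submodule ℂ (QuditSpace d n)) : ℝ :=
  Real.logb d (Module.finrank ℂ Q) / n

/-- The fidelity of the code `Q` for the map `T` (channel followed by recovery): the minimum over
all orthonormal bases `B` of `Q` of `(1 / K) * ∑ ψ ∈ B, ⟨ψ| T(|ψ⟩⟨ψ|) |ψ⟩`. -/
def fidelity {n : ℕ} (Q : Submodule ℂ (QuditSpace d n)) (T : Op d n → Op d n) : ℝ :=
  ⨅ B : OrthonormalBasis (Fin (Module.finrank ℂ Q)) ℂ Q,
    (1 / (Module.finrank ℂ Q : ℝ)) *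
      ∑ i, (inner ℂ (B i : QuditSpace d n)
        (T (InnerProductSpace.rankOne ℂ (B i : QuditSpace d n) (B i : QuditSpace d n))
          (B i : QuditSpace d n))).re

/-- The logarithm to the base `b` with `log 0 = -∞`. (It is applied to nonnegative numbers and
to `1 - F`, which is nonnegative if the channel preserves traces.) -/
def elogb (b y : ℝ) : EReal := if y ≤ 0 then ⊥ else (Real.logb b y : EReal)

/-- The error exponent `E(n, R, 𝒲)`: the supremum of `-(1 / n) log_d (1 - F)` over all codes
`Q ≠ 0` of rate at least `R` in the `n`-qudit space and all recovery operators, that is, all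
completely positive trace-preserving maps on the operators on that space. -/
def errorExponent (𝒲 : QDMC d) (ω : ℂ) (n : ℕ) (R : ℝ) : EReal :=
  ⨆ (Q : Submodule ℂ (QuditSpace d n)) (_ : Q ≠ ⊥) (_ : R ≤ rate Q)
    (𝓡 : CompletelyPositiveMap (Op d n) (Op d n))
    (_ : ∀ S : Op d n, LinearMap.trace ℂ (QuditSpace d n) (𝓡 S : Op d n) =
      LinearMap.trace ℂ (QuditSpace d n) S),
    -(((1 / (n : ℝ) : ℝ) : EReal) * elogb d (1 - fidelity Q fun S => 𝓡 (𝒲.apply ω n S)))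

/-- The reliability `E(R, 𝒲)`. -/
def reliability (𝒲 : QDMC d) (ω : ℂ) (R : ℝ) : EReal :=
  Filter.liminf (fun n : ℕ => errorExponent 𝒲 ω n R) Filter.atTop

/-- The entropy `H(P)`, to the base `d`. -/
def entropy (P : Alphabet d → ℝ) : ℝ := -∑ x, P x * Real.logb d (P x)

/-- The `W`-weight `|x|_W` of a letter, which is `+∞` if the sum vanishes. -/
def weight (𝒲 : QDMC d) (x : Alphabet d) : EReal :=
  -elogb d (∑ e, Real.sqrt (𝒲.W e * 𝒲.W (e - x)))

/-- The values `∑ x, P x |x|_W - (R + H(P) - 1)`, for the probability distributions `P` on the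
alphabet with `H(P) ≥ 1 - R`. In `EReal`, `0 * ⊤ = 0`. -/
def expurgationValues (𝒲 : QDMC d) (R : ℝ) : Set EReal :=
  {t | ∃ P ∈ stdSimplex ℝ (Alphabet d), 1 - R ≤ entropy P ∧
    t = (∑ x, (P x : EReal) * weight 𝒲 x) - ((R + entropy P - 1 : ℝ) : EReal)}

/-- The expurgation exponent `E_x(R, 𝒲)`. -/
def expurgationExponent (𝒲 : QDMC d) (R : ℝ) : EReal := sInf (expurgationValues 𝒲 R)

end QuantumChannel

end

/-! The codes are stabilizer codes. A subspace `L` of dimension `n - k`, `k = ⌈n * R⌉₊`, isotropic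
for `symp`, makes the operators `weyl ψ l`, `l ∈ L`, commute; a joint eigenspace has dimension `d ^
k` and is the code. An error moves it to another joint eigenspace, which determines the coset of the
error modulo `M = Lᗮ`. The recovery measures this coset and undoes its most likely member; errors
differing by an element of `L` act alike on the code up to a phase.

The channel adds errors coherently, but averaging over the eigenvalue systems of `L` removes the
interference (`sum_norm_sq_symp`), so some eigenspace has `1 - F` at most the classical probability
of a wrong decision. This is at most the sum over `z ∈ M \ L` of the Bhattacharyya coefficients `∏
i, 𝒲.bhatt (z i)` (`decoding_error_le`, `exists_code`).

Expurgation is the choice of `L`. Adding suitable vectors one at a time divides the sum over `M \ L`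
of a nonnegative weight by at least `d` each time (`exists_extend_isotropic`). The weight is
`typeProb`, about `d ^ (-n H(P))` on type `P`, whose total is polynomial in `n`. Hence every type in
`M \ L` has entropy at least `1 - R - o(1)`, and on such types `∏ i, 𝒲.bhatt (z i)` is at most about
`d ^ (-n E_x)` times `d ^ (n - k) * typeProb z`, which sums to a polynomial (`prod_bhatt_le`).
Compactness removes the slack in the entropy constraint (`exists_entropy_slack`). -/

noncomputable section

set_option linter.unusedSectionVars false

namespace QuantumChannel

open Finset

/-! ### The symplectic form on error words -/

section SymplecticForm

variable {d n : ℕ}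

/-- The standard symplectic form on the words of length `n` over the alphabet. -/
def symp (d n : ℕ) : LinearMap.BilinForm (ZMod d) (Fin n → Alphabet d) :=
  LinearMap.mk₂ (ZMod d) (fun v w => ∑ i, ((v i).1 * (w i).2 - (v i).2 * (w i).1))
    (fun v v' w => by rw [← sum_add_distrib]; exact sum_congr rfl fun i _ => by simp; ring)
    (fun c v w => by rw [smul_sum]; exact sum_congr rfl fun i _ => by simp; ring)
    (fun v w w' => by rw [← sum_add_distrib]; exact sum_congr rfl fun i _ => by simp; ring)
    (fun c v w => by rw [smul_sum]; exact sum_congr rfl fun i _ => by simp; ring)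

theorem symp_apply (v w : Fin n → Alphabet d) :
    symp d n v w = ∑ i, ((v i).1 * (w i).2 - (v i).2 * (w i).1) := rfl

theorem symp_isAlt : (symp d n).IsAlt := fun v => by
  simp [symp_apply, mul_comm]

theorem symp_swap (v w : Fin n → Alphabet d) : symp d n v w = -symp d n w v :=
  ((symp_isAlt (d := d) (n := n)).neg_eq w v).symm

theorem exists_symp_ne_zero [NeZero d] {v : Fin n → Alphabet d} (hv : v ≠ 0) :
    ∃ w, symp d n w v ≠ 0 := by
  obtain ⟨i, hi⟩ := Function.ne_iff.mp hv
  by_cases h : (v i).1 = 0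
  · refine ⟨Pi.single i (1, 0), ?_⟩
    have h2 : (v i).2 ≠ 0 := fun h2 => hi (Prod.ext h h2)
    rw [symp_apply, Finset.sum_eq_single i]
    · simpa using h2
    · intro j _ hj; simp [Pi.single_eq_of_ne hj]
    · simp
  · refine ⟨Pi.single i (0, 1), ?_⟩
    rw [symp_apply, Finset.sum_eq_single i]
    · simpa using h
    · intro j _ hj; simp [Pi.single_eq_of_ne hj]
    · simp

theorem symp_nondegenerate [NeZero d] : (symp d n).Nondegenerate := by
  have h : ∀ v : Fin n → Alphabet d, (∀ w, symp d n w v = 0) → v = 0 := fun v hv => by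
    by_contra h
    obtain ⟨w, hw⟩ := exists_symp_ne_zero h
    exact hw (hv w)
  exact ⟨fun v hv => h v fun w => by rw [symp_swap, hv, neg_zero], h⟩

end SymplecticForm

/-! ### Weyl operators: products, commutation, traces -/

section Weyl

open Matrix

variable {d n : ℕ} [NeZero d] (ψ : AddChar (ZMod d) ℂ)

/-- The `n`-fold tensor products of the error basis, with phases given by the character `ψ`. -/
def weyl (v : Fin n → Alphabet d) : Matrix (Fin n → ZMod d) (Fin n → ZMod d) ℂ :=
  Matrix.of fun r c => if r = c - (fun i => (v i).1) then ψ (∑ i, (v i).2 * c i) else 0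

theorem weyl_apply (v : Fin n → Alphabet d) (r c : Fin n → ZMod d) :
    weyl ψ v r c = if r = c - (fun i => (v i).1) then ψ (∑ i, (v i).2 * c i) else 0 := rfl

theorem addChar_sum {ι : Type*} (s : Finset ι) (f : ι → ZMod d) :
    ψ (∑ i ∈ s, f i) = ∏ i ∈ s, ψ (f i) := by
  induction s using Finset.cons_induction with
  | empty => simp
  | cons a s ha ih => rw [sum_cons, prod_cons, AddChar.map_add_eq_mul, ih]

/-- The cocycle of the projective representation `weyl`. -/
def cocycle (v w : Fin n → Alphabet d) : ℂ := ψ (-∑ i, (v i).2 * (w i).1)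

theorem cocycle_ne_zero (v w : Fin n → Alphabet d) : cocycle ψ v w ≠ 0 :=
  (ψ.val_isUnit _).ne_zero

theorem norm_cocycle (v w : Fin n → Alphabet d) : ‖cocycle ψ v w‖ = 1 := ψ.norm_apply _

theorem weyl_mul (v w : Fin n → Alphabet d) :
    weyl ψ v * weyl ψ w = cocycle ψ v w • weyl ψ (v + w) := by
  ext r c
  rw [Matrix.mul_apply, Finset.sum_eq_single (c - fun i => (w i).1)]
  · have h : (c - (fun i => (w i).1) - fun i => (v i).1) = c - fun i => ((v + w) i).1 := by
      ext i; simp; ring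
    simp only [weyl_apply, Matrix.smul_apply, h, if_true]
    split_ifs with h1
    · rw [← AddChar.map_add_eq_mul, smul_eq_mul, cocycle, ← AddChar.map_add_eq_mul]
      congr 1
      rw [← sum_neg_distrib, ← sum_add_distrib, ← sum_add_distrib]
      exact sum_congr rfl fun i _ => by simp; ring
    · simp
  · intro b _ hb
    rw [weyl_apply ψ w, if_neg hb, mul_zero]
  · simp

theorem weyl_zero : weyl ψ (0 : Fin n → Alphabet d) = 1 := by
  ext r c
  have : (c - fun i => ((0 : Fin n → Alphabet d) i).1) = c := by ext; simp
  rw [weyl_apply, this]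
  simp [Matrix.one_apply]

theorem cocycle_zero_left (v : Fin n → Alphabet d) : cocycle ψ 0 v = 1 := by simp [cocycle]

theorem conj_addChar (a : ZMod d) : star (ψ a) = ψ (-a) := (AddChar.map_neg_eq_conj ψ a).symm

theorem weyl_conjTranspose (v : Fin n → Alphabet d) :
    (weyl ψ v)ᴴ = (cocycle ψ v (-v))⁻¹ • weyl ψ (-v) := by
  ext r c
  have h : c = r - (fun i => (v i).1) ↔ r = c - fun i => ((-v) i).1 := by
    constructor <;> (rintro rfl; ext i; simp)
  simp only [conjTranspose_apply, weyl_apply, Matrix.smul_apply, h]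
  split_ifs with h1
  · rw [conj_addChar, smul_eq_mul, cocycle, ← AddChar.map_neg_eq_inv, ← AddChar.map_add_eq_mul, h1]
    congr 1
    simp only [← sum_neg_distrib, ← sum_add_distrib]
    exact sum_congr rfl fun i _ => by simp; ring
  · simp

theorem weyl_mul_neg (v : Fin n → Alphabet d) :
    weyl ψ v * weyl ψ (-v) = cocycle ψ v (-v) • 1 := by
  rw [weyl_mul, add_neg_cancel, weyl_zero]

theorem weyl_mul_conjTranspose (v : Fin n → Alphabet d) : weyl ψ v * (weyl ψ v)ᴴ = 1 := by
  rw [weyl_conjTranspose, Matrix.mul_smul, weyl_mul_neg, smul_smul,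
    inv_mul_cancel₀ (cocycle_ne_zero ψ _ _), one_smul]

theorem conjTranspose_mul_weyl (v : Fin n → Alphabet d) : (weyl ψ v)ᴴ * weyl ψ v = 1 :=
  mul_eq_one_comm.mp (weyl_mul_conjTranspose ψ v)

theorem cocycle_eq_symp (v w : Fin n → Alphabet d) :
    cocycle ψ v w = ψ (symp d n v w) * cocycle ψ w v := by
  rw [cocycle, cocycle, ← AddChar.map_add_eq_mul, symp_apply]
  congr 1
  simp only [← sum_neg_distrib, ← sum_add_distrib]
  exact sum_congr rfl fun i _ => by ring

/-- The symplectic form measures the failure to commute; isotropic subspaces therefore give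
commuting families. -/
theorem weyl_commute_symp (v w : Fin n → Alphabet d) :
    weyl ψ v * weyl ψ w = ψ (symp d n v w) • (weyl ψ w * weyl ψ v) := by
  rw [weyl_mul, weyl_mul, smul_smul, ← cocycle_eq_symp, add_comm]

theorem weyl_conj (v w : Fin n → Alphabet d) :
    weyl ψ v * weyl ψ w * (weyl ψ v)ᴴ = ψ (symp d n v w) • weyl ψ w := by
  rw [weyl_commute_symp, Matrix.smul_mul, Matrix.mul_assoc, weyl_mul_conjTranspose, Matrix.mul_one]

variable {ψ}

theorem apply_ne_one_of_injective (hψ : Function.Injective ψ) {a : ZMod d} (ha : a ≠ 0) :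
    ψ a ≠ 1 := fun h => ha (hψ (h.trans ψ.map_zero_eq_one.symm))

theorem sum_symp_eq_zero (hψ : Function.Injective ψ) {v : Fin n → Alphabet d} (hv : v ≠ 0) :
    ∑ w, ψ (symp d n w v) = 0 := by
  obtain ⟨w₀, hw₀⟩ := exists_symp_ne_zero hv
  have h : ∑ w, ψ (symp d n w v) = ψ (symp d n w₀ v) * ∑ w, ψ (symp d n w v) := by
    rw [mul_sum, ← Equiv.sum_comp (Equiv.addLeft w₀)]
    exact sum_congr rfl fun w _ => by
      rw [← AddChar.map_add_eq_mul, Equiv.coe_addLeft, map_add, LinearMap.add_apply]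
  by_contra h0
  exact apply_ne_one_of_injective hψ hw₀ (mul_right_cancel₀ h0 (by rw [one_mul]; exact h.symm))

theorem trace_weyl_of_ne_zero (hψ : Function.Injective ψ) {v : Fin n → Alphabet d} (hv : v ≠ 0) :
    (weyl ψ v).trace = 0 := by
  obtain ⟨w, hw⟩ := exists_symp_ne_zero hv
  have h : (weyl ψ v).trace = ψ (symp d n w v) * (weyl ψ v).trace := by
    rw [← smul_eq_mul, ← Matrix.trace_smul, ← weyl_conj, Matrix.trace_mul_comm, ← Matrix.mul_assoc,
      conjTranspose_mul_weyl, Matrix.one_mul]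
  by_contra h0
  exact apply_ne_one_of_injective hψ hw (mul_right_cancel₀ h0 (by rw [one_mul]; exact h.symm))

theorem trace_weyl_zero : (weyl ψ (0 : Fin n → Alphabet d)).trace = (d : ℂ) ^ n := by
  rw [weyl_zero, Matrix.trace_one]; simp

end Weyl

/-! ### The channel in the Weyl basis -/

section ErrorBasis

variable {d : ℕ} [NeZero d]

theorem shiftX_pow (m : ℕ) :
    shiftX d ^ m = Matrix.of fun r c => if r = c - (m : ZMod d) then 1 else 0 := by
  induction m with
  | zero => ext r c; simp [Matrix.one_apply]
  | succ m ih =>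
    rw [pow_succ, ih]
    ext r c
    rw [Matrix.mul_apply, Finset.sum_eq_single (c - 1)]
    · have : c - 1 - (m : ZMod d) = c - ((m + 1 : ℕ) : ZMod d) := by push_cast; ring
      simp [shiftX, this]
    · intro b _ hb; simp [shiftX, hb]
    · simp

theorem errorOp_apply {ω : ℂ} (hω : ω ^ d = 1) (v : Alphabet d) (r c : ZMod d) :
    errorOp d ω v r c = if r = c - v.1 then AddChar.zmodChar d hω (v.2 * c) else 0 := by
  have h : AddChar.zmodChar d hω (v.2 * c) = (ω ^ c.val) ^ v.2.val := by
    rw [← pow_mul, ← AddChar.zmodChar_apply' hω]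
    congr 1
    simp [mul_comm]
  rw [errorOp, phaseZ, Matrix.diagonal_pow, Matrix.mul_diagonal, shiftX_pow, h]
  simp

theorem prod_errorOp {ω : ℂ} (hω : ω ^ d = 1) {n : ℕ} (v : Fin n → Alphabet d)
    (r c : Fin n → ZMod d) :
    ∏ i, errorOp d ω (v i) (r i) (c i) = weyl (AddChar.zmodChar d hω) v r c := by
  simp only [errorOp_apply hω, weyl_apply]
  split_ifs with h
  · rw [addChar_sum]
    exact prod_congr rfl fun i _ => by rw [if_pos (by rw [h]; rfl)]
  · obtain ⟨i, hi⟩ := Function.ne_iff.mp h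
    exact prod_eq_zero (mem_univ i) (if_neg hi)

/-- The coefficients of `A_{u₁} ⊗ ⋯ ⊗ A_{uₙ}` in the `n`-fold error basis. -/
def QDMC.coeffN (𝒲 : QDMC d) {n : ℕ} (u v : Fin n → Alphabet d) : ℂ := ∏ i, 𝒲.a (u i) (v i)

/-- The `n`-fold product of the distribution `W`. -/
def QDMC.WN (𝒲 : QDMC d) {n : ℕ} (v : Fin n → Alphabet d) : ℝ := ∏ i, 𝒲.W (v i)

theorem QDMC.krausN_eq (𝒲 : QDMC d) {ω : ℂ} (hω : ω ^ d = 1) {n : ℕ} (u : Fin n → Alphabet d) :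
    𝒲.krausN ω u = Matrix.toEuclideanCLM (n := Fin n → ZMod d) (𝕜 := ℂ)
      (∑ v, 𝒲.coeffN u v • weyl (AddChar.zmodChar d hω) v) := by
  rw [QDMC.krausN]
  congr 1
  ext r c
  simp only [Matrix.of_apply, QDMC.kraus, Matrix.sum_apply, Matrix.smul_apply]
  rw [Finset.prod_univ_sum, Fintype.piFinset_univ]
  exact sum_congr rfl fun v _ => by
    simp only [smul_eq_mul]
    rw [prod_mul_distrib, prod_errorOp hω, QDMC.coeffN]

theorem QDMC.W_nonneg (𝒲 : QDMC d) (v : Alphabet d) : 0 ≤ 𝒲.W v :=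
  sum_nonneg fun _ _ => by positivity

theorem QDMC.sum_W (𝒲 : QDMC d) : ∑ v, 𝒲.W v = 1 := 𝒲.sum_normSq

theorem QDMC.WN_nonneg (𝒲 : QDMC d) {n : ℕ} (v : Fin n → Alphabet d) : 0 ≤ 𝒲.WN v :=
  prod_nonneg fun _ _ => 𝒲.W_nonneg _

theorem QDMC.sum_WN (𝒲 : QDMC d) (n : ℕ) : ∑ v : Fin n → Alphabet d, 𝒲.WN v = 1 := by
  have := Finset.prod_univ_sum (fun _ : Fin n => (univ : Finset (Alphabet d))) (fun _ v => 𝒲.W v)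
  rw [Fintype.piFinset_univ] at this
  simp only [QDMC.WN, ← this, 𝒲.sum_W, prod_const_one]

theorem QDMC.sum_norm_coeffN (𝒲 : QDMC d) {n : ℕ} (v : Fin n → Alphabet d) :
    ∑ u, ‖𝒲.coeffN u v‖ ^ 2 = 𝒲.WN v := by
  have := Finset.prod_univ_sum (fun _ : Fin n => (univ : Finset (Alphabet d)))
    (fun i u => ‖𝒲.a u (v i)‖ ^ 2)
  rw [Fintype.piFinset_univ] at this
  simp only [QDMC.WN, QDMC.W, QDMC.coeffN, norm_prod, ← prod_pow, this]

end ErrorBasis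

/-! ### Stabilizer projections -/

section Stabilizer

open Matrix

open scoped Classical

variable {d n : ℕ} [NeZero d] {ψ : AddChar (ZMod d) ℂ} {L : Submodule (ZMod d) (Fin n → Alphabet d)}

/-- A character of `L` twisted by the cocycle: `χ l` is the eigenvalue of `weyl ψ l` on a joint
eigenspace. -/
structure IsTwistedChar (ψ : AddChar (ZMod d) ℂ) (L : Submodule (ZMod d) (Fin n → Alphabet d))
    (χ : (Fin n → Alphabet d) → ℂ) : Prop where
  mul : ∀ l ∈ L, ∀ m ∈ L, χ l * χ m = cocycle ψ l m * χ (l + m)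
  norm : ∀ l ∈ L, ‖χ l‖ = 1

theorem nonempty_algHom_complex (A : Type*) [CommRing A] [Nontrivial A] [Algebra ℂ A]
    [FiniteDimensional ℂ A] : Nonempty (A →ₐ[ℂ] ℂ) := by
  obtain ⟨M, hM⟩ := Ideal.exists_maximal A
  let _ : Field (A ⧸ M) := Ideal.Quotient.field M
  have hb : Function.Bijective (algebraMap ℂ (A ⧸ M)) :=
    IsAlgClosed.algebraMap_bijective_of_isIntegral
  exact ⟨((AlgEquiv.ofBijective (Algebra.ofId ℂ (A ⧸ M)) hb).symm : (A ⧸ M) →ₐ[ℂ] ℂ).comp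
    (Ideal.Quotient.mkₐ ℂ M)⟩

open scoped IsMulCommutative in
theorem nonempty_algHom_adjoin {A : Type*} [Ring A] [Nontrivial A] [Algebra ℂ A]
    [FiniteDimensional ℂ A] {s : Set A} (hs : ∀ a ∈ s, ∀ b ∈ s, a * b = b * a) :
    Nonempty (Algebra.adjoin ℂ s →ₐ[ℂ] ℂ) := by
  have := Algebra.isMulCommutative_adjoin ℂ hs
  exact nonempty_algHom_complex (Algebra.adjoin ℂ s)

/-- The commuting operators `weyl ψ l` generate a finite-dimensional commutative algebra; a
character of it, which exists since ℂ is algebraically closed, supplies `χ`. The relation `d • l =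
0` forces `‖χ l‖ ^ d = 1`. No phases have to be chosen, so `d = 2` needs no special care. -/
theorem exists_isTwistedChar (ψ : AddChar (ZMod d) ℂ) (hL : L ≤ (symp d n).orthogonal L) :
    ∃ χ, IsTwistedChar ψ L χ := by
  obtain ⟨f⟩ := nonempty_algHom_adjoin (s := Set.image (weyl ψ) (L : Set (Fin n → Alphabet d))) (by
    rintro _ ⟨l, hl, rfl⟩ _ ⟨m, hm, rfl⟩
    rw [weyl_commute_symp, hL hm l hl, AddChar.map_zero_eq_one, one_smul])
  have hmem : ∀ l ∈ L,
      weyl ψ l ∈ Algebra.adjoin ℂ (Set.image (weyl ψ) (L : Set (Fin n → Alphabet d))) :=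
    fun l hl => Algebra.subset_adjoin ⟨l, hl, rfl⟩
  let χ : (Fin n → Alphabet d) → ℂ := fun l => if hl : l ∈ L then f ⟨_, hmem l hl⟩ else 0
  have hχ : ∀ l (hl : l ∈ L), χ l = f ⟨_, hmem l hl⟩ := fun l hl => dif_pos hl
  have hmul : ∀ l ∈ L, ∀ m ∈ L, χ l * χ m = cocycle ψ l m * χ (l + m) := fun l hl m hm => by
    rw [hχ l hl, hχ m hm, hχ _ (L.add_mem hl hm), ← map_mul, ← smul_eq_mul (cocycle ψ l m),
      ← map_smul]
    congr 1
    exact Subtype.ext (weyl_mul ψ l m)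
  have h0 : χ 0 = 1 := by
    rw [hχ 0 L.zero_mem, ← map_one f]
    congr 1
    exact Subtype.ext (weyl_zero ψ)
  have hpow : ∀ l ∈ L, ∀ k : ℕ, ‖χ (k • l)‖ = ‖χ l‖ ^ k := fun l hl k => by
    induction k with
    | zero => simp [h0]
    | succ k ih =>
      have := congrArg norm (hmul _ (L.nsmul_mem hl k) l hl)
      rw [norm_mul, norm_mul, norm_cocycle, one_mul] at this
      rw [succ_nsmul, ← this, ih, pow_succ]
  refine ⟨χ, hmul, fun l hl => ?_⟩
  have h := hpow l hl d
  rw [show d • l = 0 by ext i <;> simp, h0, norm_one] at h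
  exact (pow_eq_one_iff_of_nonneg (norm_nonneg _) (NeZero.ne d)).mp h.symm

variable {χ : (Fin n → Alphabet d) → ℂ}

theorem IsTwistedChar.ne_zero (hχ : IsTwistedChar ψ L χ) {l : Fin n → Alphabet d} (hl : l ∈ L) :
    χ l ≠ 0 := fun h => by simpa [h] using hχ.norm l hl

theorem IsTwistedChar.map_zero (hχ : IsTwistedChar ψ L χ) : χ 0 = 1 := by
  have h := hχ.mul 0 L.zero_mem 0 L.zero_mem
  rw [cocycle_zero_left, add_zero] at h
  exact mul_right_cancel₀ (hχ.ne_zero L.zero_mem) h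

theorem IsTwistedChar.inv_mul_cocycle (hχ : IsTwistedChar ψ L χ) {l m : Fin n → Alphabet d}
    (hl : l ∈ L) (hm : m ∈ L) : (χ l)⁻¹ * cocycle ψ m l = χ m * (χ (m + l))⁻¹ := by
  have h := hχ.mul m hm l hl
  have h1 := hχ.ne_zero hl
  have h2 := hχ.ne_zero (L.add_mem hm hl)
  field_simp
  rw [← h, mul_comm]

/-- The twists supply the family of eigenspaces over which the fidelity is averaged. -/
theorem IsTwistedChar.twist (hχ : IsTwistedChar ψ L χ) (t : Fin n → Alphabet d) :
    IsTwistedChar ψ L fun l => ψ (symp d n t l) * χ l where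
  mul l hl m hm := by
    rw [mul_mul_mul_comm, hχ.mul l hl m hm, ← AddChar.map_add_eq_mul, ← map_add]
    ring
  norm l hl := by rw [norm_mul, hχ.norm l hl, ψ.norm_apply, one_mul]

/-- The projection onto the joint eigenspace of the operators `weyl ψ l`, `l ∈ L`, with the
eigenvalues `χ l`. -/
def stabProj (ψ : AddChar (ZMod d) ℂ) (L : Submodule (ZMod d) (Fin n → Alphabet d))
    (χ : (Fin n → Alphabet d) → ℂ) : Matrix (Fin n → ZMod d) (Fin n → ZMod d) ℂ :=
  (Nat.card L : ℂ)⁻¹ • ∑ l : L, (χ l)⁻¹ • weyl ψ (l : Fin n → Alphabet d)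

theorem natCast_card_ne_zero : (Nat.card L : ℂ) ≠ 0 :=
  Nat.cast_ne_zero.mpr Nat.card_pos.ne'

theorem weyl_mul_stabProj (hχ : IsTwistedChar ψ L χ) {m : Fin n → Alphabet d} (hm : m ∈ L) :
    weyl ψ m * stabProj ψ L χ = χ m • stabProj ψ L χ := by
  rw [stabProj, Matrix.mul_smul, smul_comm (χ m), Finset.mul_sum, smul_sum (r := χ m)]
  congr 1
  rw [← Equiv.sum_comp (Equiv.addLeft (⟨m, hm⟩ : L)) 
    (fun l : L => χ m • (χ l)⁻¹ • weyl ψ (l : Fin n → Alphabet d))]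
  refine sum_congr rfl fun l _ => ?_
  rw [Matrix.mul_smul, weyl_mul, smul_smul, smul_smul, hχ.inv_mul_cocycle l.2 hm]
  rfl

theorem stabProj_mul_self (hχ : IsTwistedChar ψ L χ) :
    stabProj ψ L χ * stabProj ψ L χ = stabProj ψ L χ := by
  conv_lhs => enter [1]; rw [stabProj]
  rw [Matrix.smul_mul, Finset.sum_mul]
  have : ∀ l : L, ((χ l)⁻¹ • weyl ψ (l : Fin n → Alphabet d)) * stabProj ψ L χ = stabProj ψ L χ :=
    fun l => by
      rw [Matrix.smul_mul, weyl_mul_stabProj hχ l.2, smul_smul, inv_mul_cancel₀ (hχ.ne_zero l.2),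
        one_smul]
  simp only [this, sum_const, card_univ, ← Nat.card_eq_fintype_card]
  rw [← Nat.cast_smul_eq_nsmul ℂ, smul_smul, inv_mul_cancel₀ natCast_card_ne_zero, one_smul]

theorem stabProj_conjTranspose (hχ : IsTwistedChar ψ L χ) :
    (stabProj ψ L χ)ᴴ = stabProj ψ L χ := by
  rw [stabProj, conjTranspose_smul, conjTranspose_sum, star_inv₀, star_natCast,
    ← Equiv.sum_comp (Equiv.neg L)]
  congr 1
  refine sum_congr rfl fun l _ => ?_
  rw [conjTranspose_smul, weyl_conjTranspose, smul_smul]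
  simp only [Equiv.neg_apply, Submodule.coe_neg, neg_neg]
  congr 1
  have hl := L.neg_mem l.2
  have h := hχ.inv_mul_cocycle l.2 hl
  have h1 : star (χ (-l))⁻¹ = χ (-l) := by
    rw [star_inv₀]
    exact inv_eq_of_mul_eq_one_left
      (by rw [Complex.star_def, Complex.mul_conj, Complex.normSq_eq_norm_sq, hχ.norm _ hl]; simp)
  have h2 := cocycle_ne_zero ψ (-(l : Fin n → Alphabet d)) l
  rw [neg_add_cancel, hχ.map_zero, inv_one, mul_one] at h
  rw [h1, ← h, mul_assoc, mul_inv_cancel₀ h2, mul_one]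

theorem trace_weyl_mul_stabProj_of_notMem (hψ : Function.Injective ψ) {m : Fin n → Alphabet d}
    (hm : m ∉ L) : (weyl ψ m * stabProj ψ L χ).trace = 0 := by
  rw [stabProj, Matrix.mul_smul, Matrix.trace_smul, Finset.mul_sum, Matrix.trace_sum]
  rw [Finset.sum_eq_zero, smul_zero]
  intro l _
  rw [Matrix.mul_smul, weyl_mul, Matrix.trace_smul, Matrix.trace_smul,
    trace_weyl_of_ne_zero hψ, smul_zero, smul_zero]
  intro h
  exact hm (by rw [eq_neg_of_add_eq_zero_left h]; exact L.neg_mem l.2)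

theorem trace_stabProj (hψ : Function.Injective ψ) (hχ : IsTwistedChar ψ L χ) :
    (stabProj ψ L χ).trace = (d : ℂ) ^ n / Nat.card L := by
  rw [stabProj, Matrix.trace_smul, Matrix.trace_sum, Finset.sum_eq_single 0]
  · rw [Matrix.trace_smul, Submodule.coe_zero, trace_weyl_zero, hχ.map_zero]
    simp [div_eq_inv_mul]
  · intro l _ hl
    rw [Matrix.trace_smul, trace_weyl_of_ne_zero hψ (by simpa using hl), smul_zero]
  · simp

/-- Once a correction has been applied, only a residual error in `L` contributes to the entanglement
fidelity, through its eigenvalue. -/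
theorem trace_stabProj_mul (hψ : Function.Injective ψ) (hχ : IsTwistedChar ψ L χ)
    (m : Fin n → Alphabet d) :
    (stabProj ψ L χ * weyl ψ m).trace = if m ∈ L then χ m * ((d : ℂ) ^ n / Nat.card L) else 0 := by
  rw [Matrix.trace_mul_comm]
  split_ifs with h
  · rw [weyl_mul_stabProj hχ h, Matrix.trace_smul, trace_stabProj hψ hχ, smul_eq_mul]
  · exact trace_weyl_mul_stabProj_of_notMem hψ h

/-- Since `x w - w` is orthogonal to `L`, conjugation by `x w` has the same effect on the projection
as conjugation by `w`; the sum over all `w` then kills every term but `l = 0`. This makes the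
recovery trace preserving. -/
theorem sum_conj_stabProj (hψ : Function.Injective ψ) (hχ : IsTwistedChar ψ L χ)
    {x : (Fin n → Alphabet d) → (Fin n → Alphabet d)}
    (hx : ∀ w, x w - w ∈ (symp d n).orthogonal L) :
    ∑ w, weyl ψ (x w) * stabProj ψ L χ * (weyl ψ (x w))ᴴ =
      (((d : ℂ) ^ n) ^ 2 / Nat.card L) • 1 := by
  have h : ∀ w, weyl ψ (x w) * stabProj ψ L χ * (weyl ψ (x w))ᴴ = (Nat.card L : ℂ)⁻¹ •
      ∑ l : L, ((χ l)⁻¹ * ψ (symp d n w l)) • weyl ψ (l : Fin n → Alphabet d) := fun w => by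
    rw [stabProj, Matrix.mul_smul, Matrix.smul_mul, Finset.mul_sum, Finset.sum_mul]
    congr 1
    refine sum_congr rfl fun l _ => ?_
    rw [Matrix.mul_smul, Matrix.smul_mul, weyl_conj, smul_smul]
    congr 3
    have : symp d n l (x w - w) = 0 := hx w l l.2
    rw [symp_swap, neg_eq_zero, map_sub, LinearMap.sub_apply, sub_eq_zero] at this
    exact this
  simp only [h]
  rw [← smul_sum, sum_comm, Finset.sum_eq_single 0]
  · rw [← sum_smul, ← mul_sum]
    simp only [Submodule.coe_zero, map_zero, AddChar.map_zero_eq_one, hχ.map_zero, weyl_zero,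
      smul_smul]
    congr 1
    simp only [sum_const, card_univ, Fintype.card_pi, Fintype.card_prod, ZMod.card, prod_const,
      Fintype.card_fin, nsmul_eq_mul]
    push_cast
    ring
  · intro l _ hl
    rw [← sum_smul, ← mul_sum, sum_symp_eq_zero hψ (by simpa using hl), mul_zero, zero_smul]
  · simp

end Stabilizer

/-! ### Complete positivity of Kraus maps -/

section Kraus

/-- The map `S ↦ ∑ i, K i * S * (K i)^*` is completely positive. -/
def krausCP {A ι : Type*} [CStarAlgebra A] [PartialOrder A] [StarOrderedRing A] [Fintype ι]
    (K : ι → A) : CompletelyPositiveMap A A where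
  toFun S := ∑ i, K i * S * star (K i)
  map_add' S T := by simp only [mul_add, add_mul, sum_add_distrib]
  map_smul' c S := by simp only [mul_smul_comm, smul_mul_assoc, smul_sum, RingHom.id_apply]
  map_cstarMatrix_nonneg' k M hM := by
    -- The amplification of conjugation by `K i` to matrices is conjugation by the constant diagonal
    -- matrix.
    let D : ι → CStarMatrix (Fin k) (Fin k) A := fun i =>
      CStarMatrix.ofMatrix (Matrix.diagonal fun _ => K i)
    have h : (M.map fun S => ∑ i, K i * S * star (K i)) = ∑ i, D i * M * star (D i) := by
      have hD : ∀ i, star (D i) = CStarMatrix.ofMatrix (Matrix.diagonal fun _ => star (K i)) :=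
        fun i => congrArg CStarMatrix.ofMatrix (Matrix.diagonal_conjTranspose fun _ : Fin k => K i)
      have hs : ∀ (f : ι → CStarMatrix (Fin k) (Fin k) A) (r c : Fin k),
          (∑ i, f i) r c = ∑ i, f i r c := fun f r c => Matrix.sum_apply r c univ f
      refine CStarMatrix.ext fun r c => ?_
      rw [hs, CStarMatrix.map_apply]
      refine sum_congr rfl fun i _ => ?_
      rw [hD]
      have h1 : (D i * M) r c = K i * M r c :=
        Matrix.diagonal_mul (fun _ : Fin k => K i) (CStarMatrix.ofMatrix.symm M) r c
      have h2 : (D i * M * (CStarMatrix.ofMatrix (Matrix.diagonal fun _ => star (K i)) :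
          CStarMatrix (Fin k) (Fin k) A) : CStarMatrix (Fin k) (Fin k) A) r c =
          (D i * M) r c * star (K i) :=
        Matrix.mul_diagonal (fun _ : Fin k => star (K i)) (CStarMatrix.ofMatrix.symm (D i * M)) r c
      rw [h2, h1]
    change 0 ≤ M.map fun S => ∑ i, K i * S * star (K i)
    rw [h]
    exact sum_nonneg fun i _ => star_right_conjugate_nonneg hM (D i)

theorem krausCP_apply {A ι : Type*} [CStarAlgebra A] [PartialOrder A] [StarOrderedRing A]
    [Fintype ι] (K : ι → A) (S : A) : krausCP K S = ∑ i, K i * S * star (K i) := rfl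

end Kraus

/-! ### Entanglement fidelity as a lower bound -/

section Fidelity

variable {d n : ℕ} [NeZero d]

theorem re_inner_conj_rankOne (M : Op d n) (x : QuditSpace d n) :
    (inner ℂ x ((M * InnerProductSpace.rankOne ℂ x x * star M) x)).re = ‖inner ℂ x (M x)‖ ^ 2 := by
  rw [mul_apply_eq_comp, mul_apply_eq_comp,
    InnerProductSpace.rankOne_apply, map_smul, inner_smul_right,
    ContinuousLinearMap.star_eq_adjoint, ContinuousLinearMap.adjoint_inner_right,
    ← inner_conj_symm, ← Complex.normSq_eq_conj_mul_self, Complex.ofReal_re,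
    Complex.normSq_eq_norm_sq]

theorem sum_inner_eq_trace {p : Op d n} (hp : IsStarProjection p)
    (B : OrthonormalBasis (Fin (Module.finrank ℂ p.range)) ℂ p.range) (M : Op d n) :
    ∑ i, inner ℂ (B i : QuditSpace d n) (M (B i)) =
      LinearMap.trace ℂ (QuditSpace d n) (M * p : Op d n) := by
  obtain ⟨_, h⟩ := isStarProjection_iff_eq_starProjection_range.mp hp
  have h2 : M * p = ∑ i, InnerProductSpace.rankOne ℂ (M (B i)) (B i : QuditSpace d n) := by
    conv_lhs => rw [h, B.starProjection_eq_sum_rankOne, mul_sum]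
    exact sum_congr rfl fun i _ => InnerProductSpace.comp_rankOne _ _ _
  rw [h2, ContinuousLinearMap.toLinearMap_sum, map_sum]
  exact sum_congr rfl fun i _ => (InnerProductSpace.trace_rankOne _ _).symm

theorem trace_eq_finrank {p : Op d n} (hp : IsStarProjection p) :
    LinearMap.trace ℂ (QuditSpace d n) p = Module.finrank ℂ p.range := by
  have h := sum_inner_eq_trace hp (stdOrthonormalBasis ℂ p.range) 1
  rw [one_mul] at h
  rw [← h]
  have : ∀ i, inner ℂ (stdOrthonormalBasis ℂ p.range i : QuditSpace d n)
      ((1 : Op d n) (stdOrthonormalBasis ℂ p.range i)) = 1 := fun i => by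
    rw [one_apply_eq_self, ← Submodule.coe_inner, inner_self_eq_norm_sq_to_K,
      (stdOrthonormalBasis ℂ p.range).orthonormal.1 i]
    simp
  rw [sum_congr rfl fun i _ => this i]
  simp

/-- The fidelity of the range of a projection is bounded below by the entanglement fidelity. -/
theorem le_fidelity {ι κ : Type*} [Fintype ι] [Fintype κ] {p : Op d n} (hp : IsStarProjection p)
    (K : ι → Op d n) (A : κ → Op d n) :
    ∑ w, ∑ u, ‖LinearMap.trace ℂ (QuditSpace d n) (K w * A u * p : Op d n)‖ ^ 2 /
        (Module.finrank ℂ p.range : ℝ) ^ 2 ≤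
      fidelity p.range fun S => krausCP K (∑ u, A u * S * ContinuousLinearMap.adjoint (A u)) := by
  have : Nonempty (OrthonormalBasis (Fin (Module.finrank ℂ p.range)) ℂ p.range) :=
    ⟨stdOrthonormalBasis ℂ p.range⟩
  refine le_ciInf fun B => ?_
  have h : ∀ x : QuditSpace d n, (inner ℂ x ((krausCP K (∑ u, A u *
      InnerProductSpace.rankOne ℂ x x * ContinuousLinearMap.adjoint (A u))) x)).re =
      ∑ w, ∑ u, ‖inner ℂ x ((K w * A u) x)‖ ^ 2 := fun x => by
    simp only [krausCP_apply, mul_sum, sum_mul, _root_.sum_apply, inner_sum,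
      Complex.re_sum]
    refine sum_congr rfl fun w _ => sum_congr rfl fun u _ => ?_
    rw [← re_inner_conj_rankOne, star_mul, ContinuousLinearMap.star_eq_adjoint (A u)]
    simp only [mul_assoc]
  simp only [h]
  conv_rhs => rw [sum_comm, mul_sum]
  refine sum_le_sum fun w _ => ?_
  conv_rhs => rw [sum_comm, mul_sum]
  refine sum_le_sum fun u _ => ?_
  rw [← sum_inner_eq_trace hp B]
  rcases Nat.eq_zero_or_pos (Module.finrank ℂ p.range) with h0 | hpos
  · have hK : (Module.finrank ℂ p.range : ℝ) = 0 := by rw [h0, Nat.cast_zero]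
    rw [hK, zero_pow two_ne_zero, div_zero, div_zero, zero_mul]
  · have hK : (0 : ℝ) < Module.finrank ℂ p.range := by exact_mod_cast hpos
    -- Cauchy–Schwarz over the basis; the trace on the left does not depend on `B`, so the bound
    -- survives the minimum.
    have h1 := sq_sum_le_card_mul_sum_sq (s := univ)
      (f := fun i => ‖inner ℂ (B i : QuditSpace d n) ((K w * A u) (B i))‖)
    rw [card_univ, Fintype.card_fin] at h1
    have h2 : ‖∑ i, inner ℂ (B i : QuditSpace d n) ((K w * A u) (B i))‖ ^ 2 ≤
        (∑ i, ‖inner ℂ (B i : QuditSpace d n) ((K w * A u) (B i))‖) ^ 2 := by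
      gcongr
      exact norm_sum_le _ _
    rw [div_le_iff₀ (by positivity)]
    refine (h2.trans h1).trans (le_of_eq ?_)
    field_simp

theorem trace_krausCP {ι : Type*} [Fintype ι] {K : ι → Op d n} (hK : ∑ i, star (K i) * K i = 1)
    (S : Op d n) : LinearMap.trace ℂ (QuditSpace d n) (krausCP K S : Op d n) =
      LinearMap.trace ℂ (QuditSpace d n) S := by
  have h : ∀ i, LinearMap.trace ℂ (QuditSpace d n) (K i * S * star (K i) : Op d n) =
      LinearMap.trace ℂ (QuditSpace d n) (star (K i) * K i * S : Op d n) := fun i => by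
    rw [mul_assoc (star _)]
    exact LinearMap.trace_mul_comm ℂ (K i * S : Op d n).toLinearMap (star (K i)).toLinearMap
  rw [krausCP_apply, ContinuousLinearMap.toLinearMap_sum, map_sum]
  simp only [h]
  rw [← map_sum, ← ContinuousLinearMap.toLinearMap_sum, ← sum_mul, hK, one_mul]

theorem trace_toEuclideanCLM (M : Matrix (Fin n → ZMod d) (Fin n → ZMod d) ℂ) :
    LinearMap.trace ℂ (QuditSpace d n) (Matrix.toEuclideanCLM (n := Fin n → ZMod d) (𝕜 := ℂ) M) =
      M.trace := by
  rw [Matrix.coe_toEuclideanCLM_eq_toEuclideanLin, Matrix.toEuclideanLin_eq_toLin_orthonormal,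
    Matrix.trace_toLin_eq]

end Fidelity

open scoped Classical

/-! ### Maximum likelihood decoding and Bhattacharyya coefficients -/

section Decoding

variable {G R : Type*} [Ring R] [AddCommGroup G] [Module R G] [Fintype G]

theorem sum_sum_coset (M : Submodule R G) (f : G → ℝ) :
    ∑ w, ∑ v, (if v - w ∈ M then f v else 0) = Nat.card M * ∑ v, f v := by
  rw [sum_comm, mul_sum]
  refine sum_congr rfl fun v _ => ?_
  rw [← Equiv.sum_comp (Equiv.subLeft v), ← sum_filter, sum_const, nsmul_eq_mul,
    Nat.card_eq_fintype_card, Fintype.card_subtype]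
  simp

/-- The error probability of maximum likelihood decoding is at most a sum of Bhattacharyya
coefficients. -/
theorem decoding_error_le {L M : Submodule R G} {f : G → ℝ} (hf : ∀ v, 0 ≤ f v)
    {x : G → G} (hx : ∀ w, x w - w ∈ M) (hmax : ∀ w y, y - w ∈ M → f y ≤ f (x w)) (hL : L ≤ M) :
    Nat.card M * ∑ v, f v - ∑ w, ∑ v, (if v - x w ∈ L then f v else 0) ≤
      Nat.card M * ∑ z, if z ∈ M ∧ z ∉ L then ∑ y, √(f y * f (y - z)) else 0 := by
  have hM : ∀ w v, v - x w ∈ M ↔ v - w ∈ M := fun w v => by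
    rw [← sub_add_sub_cancel v (x w) w]
    exact (M.add_mem_iff_left (hx w)).symm
  have key : ∀ w, ∑ v, (if v - w ∈ M then f v else 0) - ∑ v, (if v - x w ∈ L then f v else 0) ≤
      ∑ z, if z ∈ M ∧ z ∉ L then ∑ y, (if y - w ∈ M then √(f y * f (y - z)) else 0) else 0 := by
    intro w
    rw [← sum_sub_distrib, ← Equiv.sum_comp (Equiv.addRight (x w))]
    refine sum_le_sum fun z _ => ?_
    rw [Equiv.coe_addRight, add_sub_cancel_right, ← hM w (z + x w), add_sub_cancel_right]
    by_cases hzL : z ∈ L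
    · simp [hzL, hL hzL]
    by_cases hzM : z ∈ M
    · simp only [hzL, hzM, if_true, if_false, sub_zero, not_false_eq_true, and_self]
      have hw : z + x w - w ∈ M := by rw [add_sub_assoc]; exact M.add_mem hzM (hx w)
      refine le_trans ?_ (single_le_sum (f := fun y => if y - w ∈ M then √(f y * f (y - z)) else 0)
        (fun y _ => by positivity) (mem_univ (z + x w)))
      simp only [hw, if_true, add_sub_cancel_left]
      -- For the true error `y = z + x w`, the decoder's choice is `y - z = x w`, which is at least
      -- as likely; so `f y` is at most the geometric mean.
      refine Real.le_sqrt_of_sq_le ?_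
      rw [sq]
      exact mul_le_mul_of_nonneg_left (hmax w _ hw) (hf _)
    · simp [hzL, hzM]
  rw [← sum_sum_coset, ← sum_sub_distrib]
  refine (sum_le_sum fun w _ => key w).trans (le_of_eq ?_)
  rw [sum_comm, mul_sum]
  refine sum_congr rfl fun z _ => ?_
  split_ifs
  · exact sum_sum_coset M _
  · simp

theorem exists_max_coset (M : Submodule R G) (f : G → ℝ) :
    ∃ x : G → G, (∀ w, x w - w ∈ M) ∧ ∀ w y, y - w ∈ M → f y ≤ f (x w) := by
  have : ∀ w, ∃ x, x - w ∈ M ∧ ∀ y, y - w ∈ M → f y ≤ f x := fun w => by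
    obtain ⟨x, hx, h⟩ := Set.exists_max_image {y | y - w ∈ M} f (Set.toFinite _)
      ⟨w, by simp⟩
    exact ⟨x, hx, h⟩
  choose x hx h using this
  exact ⟨x, hx, h⟩

end Decoding

variable {d n : ℕ} [NeZero d]

/-- The Bhattacharyya coefficient of the distribution `W` and its translate by `x`. -/
def QDMC.bhatt (𝒲 : QDMC d) (x : Alphabet d) : ℝ := ∑ e, √(𝒲.W e * 𝒲.W (e - x))

theorem QDMC.bhatt_nonneg (𝒲 : QDMC d) (x : Alphabet d) : 0 ≤ 𝒲.bhatt x :=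
  sum_nonneg fun _ _ => Real.sqrt_nonneg _

theorem QDMC.prod_bhatt (𝒲 : QDMC d) (z : Fin n → Alphabet d) :
    ∏ i, 𝒲.bhatt (z i) = ∑ y : Fin n → Alphabet d, √(𝒲.WN y * 𝒲.WN (y - z)) := by
  simp only [QDMC.bhatt]
  rw [Finset.prod_univ_sum, Fintype.piFinset_univ]
  refine sum_congr rfl fun y _ => ?_
  rw [QDMC.WN, QDMC.WN, ← prod_mul_distrib, Real.sqrt_prod]
  · rfl
  · exact fun i _ => mul_nonneg (𝒲.W_nonneg _) (𝒲.W_nonneg _)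

/-! ### Averaging out the coherences -/

section Parseval

variable {ψ : AddChar (ZMod d) ℂ}

/-- Parseval: the cross terms are character sums at `v - w ≠ 0` and vanish. -/
theorem sum_norm_sq_symp (hψ : Function.Injective ψ) (b : (Fin n → Alphabet d) → ℂ) :
    ∑ t, ‖∑ v, b v * ψ (symp d n t v)‖ ^ 2 = ((d : ℝ) ^ n) ^ 2 * ∑ v, ‖b v‖ ^ 2 := by
  rw [← Complex.ofReal_inj]
  push_cast
  simp only [← Complex.mul_conj']
  simp only [map_sum, sum_mul_sum, map_mul]
  rw [sum_comm, mul_sum]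
  refine sum_congr rfl fun v _ => ?_
  rw [sum_comm, sum_eq_single v]
  · simp only [← AddChar.map_neg_eq_conj]
    have : ∀ t, b v * ψ (symp d n t v) * ((starRingEnd ℂ) (b v) * ψ (-symp d n t v)) =
        b v * (starRingEnd ℂ) (b v) := fun t => by
      rw [mul_mul_mul_comm, ← AddChar.map_add_eq_mul, add_neg_cancel, AddChar.map_zero_eq_one,
        mul_one]
    simp only [this, sum_const, card_univ, Fintype.card_pi, Fintype.card_prod, ZMod.card,
      prod_const, Fintype.card_fin, nsmul_eq_mul]
    push_cast
    ring
  · intro w _ hw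
    have : ∀ t, b v * ψ (symp d n t v) *
        ((starRingEnd ℂ) (b w) * (starRingEnd ℂ) (ψ (symp d n t w))) =
        b v * (starRingEnd ℂ) (b w) * ψ (symp d n t (v - w)) := fun t => by
      rw [← AddChar.map_neg_eq_conj, mul_mul_mul_comm, ← AddChar.map_add_eq_mul, map_sub,
        sub_eq_add_neg]
    simp only [this]
    rw [← mul_sum, sum_symp_eq_zero hψ (sub_ne_zero.mpr hw.symm), mul_zero]
  · simp

end Parseval

/-! ### Stabilizer codes and their error probability -/

section Code

/-- The phase in `E_x^* E_v ∝ E_{v - x}`. -/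
def relPhase (ψ : AddChar (ZMod d) ℂ) (x v : Fin n → Alphabet d) : ℂ :=
  (cocycle ψ x (-x))⁻¹ * cocycle ψ (-x) v

theorem norm_relPhase (ψ : AddChar (ZMod d) ℂ) (x v : Fin n → Alphabet d) :
    ‖relPhase ψ x v‖ = 1 := by
  rw [relPhase, norm_mul, norm_inv, norm_cocycle, norm_cocycle, inv_one, one_mul]

open Matrix in
theorem conjTranspose_weyl_mul (ψ : AddChar (ZMod d) ℂ) (x v : Fin n → Alphabet d) :
    (weyl ψ x)ᴴ * weyl ψ v = relPhase ψ x v • weyl ψ (v - x) := by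
  rw [weyl_conjTranspose, Matrix.smul_mul, weyl_mul, smul_smul, relPhase, neg_add_eq_sub]

variable {L : Submodule (ZMod d) (Fin n → Alphabet d)} {ω : ℂ}

theorem zmodChar_injective (hω : IsPrimitiveRoot ω d) :
    Function.Injective (AddChar.zmodChar d hω.pow_eq_one) := fun a b hab => by
  have h := AddChar.zmodChar_primitive_of_primitive_root d hω
  exact sub_eq_zero.mp ((h.zmod_char_eq_one_iff d (a - b)).mp
    (by rw [AddChar.map_sub_eq_div, hab, div_self (AddChar.val_isUnit _ b).ne_zero]))

open Matrix in
/-- The stabilizer code of `L` with the eigenvalues `χ`, and its fidelity for the recovery which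
corrects the errors `x w`. -/
theorem exists_stabilizer_code (hω : IsPrimitiveRoot ω d) (𝒲 : QDMC d)
    (hcard : Nat.card L * Nat.card ((symp d n).orthogonal L) = (d ^ n) ^ 2)
    {x : (Fin n → Alphabet d) → (Fin n → Alphabet d)}
    (hx : ∀ w, x w - w ∈ (symp d n).orthogonal L) {χ : (Fin n → Alphabet d) → ℂ}
    (hχ : IsTwistedChar (AddChar.zmodChar d hω.pow_eq_one) L χ) :
    ∃ Q : Submodule ℂ (QuditSpace d n), Module.finrank ℂ Q * Nat.card L = d ^ n ∧
      ∃ 𝓡 : CompletelyPositiveMap (Op d n) (Op d n),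
        (∀ S : Op d n, LinearMap.trace ℂ (QuditSpace d n) (𝓡 S : Op d n) =
          LinearMap.trace ℂ (QuditSpace d n) S) ∧
        (Nat.card ((symp d n).orthogonal L) : ℝ)⁻¹ * ∑ w, ∑ u,
          ‖∑ v, if v - x w ∈ L then 𝒲.coeffN u v *
            relPhase (AddChar.zmodChar d hω.pow_eq_one) (x w) v * χ (v - x w) else 0‖ ^ 2 ≤
          fidelity Q fun S => 𝓡 (𝒲.apply ω n S) := by
  set ψ := AddChar.zmodChar d hω.pow_eq_one
  have hψ : Function.Injective ψ := zmodChar_injective hω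
  set Φ := Matrix.toEuclideanCLM (n := Fin n → ZMod d) (𝕜 := ℂ)
  set P := stabProj ψ L χ
  set M := (symp d n).orthogonal L
  have hPP : P * P = P := stabProj_mul_self hχ
  have hPH : Pᴴ = P := stabProj_conjTranspose hχ
  have hp : IsStarProjection (Φ P) :=
    ⟨by rw [IsIdempotentElem, ← map_mul, hPP], by
      rw [IsSelfAdjoint, ← map_star, Matrix.star_eq_conjTranspose, hPH]⟩
  have hL0 : (Nat.card L : ℂ) ≠ 0 := Nat.cast_ne_zero.mpr Nat.card_pos.ne'
  have hM0 : (Nat.card M : ℝ) ≠ 0 := Nat.cast_ne_zero.mpr Nat.card_pos.ne'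
  have hfr : (Module.finrank ℂ (Φ P).range : ℂ) = (d : ℂ) ^ n / Nat.card L := by
    rw [← trace_eq_finrank hp, trace_toEuclideanCLM, trace_stabProj hψ hχ]
  have hfr0 : (Module.finrank ℂ (Φ P).range : ℝ) ≠ 0 := by
    have : (Module.finrank ℂ (Φ P).range : ℂ) ≠ 0 := by
      rw [hfr]
      exact div_ne_zero (pow_ne_zero _ (Nat.cast_ne_zero.mpr (NeZero.ne d))) hL0
    exact_mod_cast this
  set c : ℝ := √((Nat.card M : ℝ)⁻¹)
  have hc : c ^ 2 = (Nat.card M : ℝ)⁻¹ := Real.sq_sqrt (by positivity)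
  -- Undo the error `x w`, then project onto the code. Since `w` runs over all words and not over
  -- coset representatives, `c ^ 2` is the inverse of the size of a coset.
  set K : (Fin n → Alphabet d) → Op d n := fun w => Φ ((c : ℂ) • (P * (weyl ψ (x w))ᴴ))
  have hK : ∑ w, star (K w) * K w = 1 := by
    have h : ∀ w, star (K w) * K w =
        Φ (((c : ℂ) ^ 2) • (weyl ψ (x w) * P * (weyl ψ (x w))ᴴ)) := fun w => by
      rw [← map_star, ← map_mul, Matrix.star_eq_conjTranspose, conjTranspose_smul,
        conjTranspose_mul, conjTranspose_conjTranspose, hPH, Matrix.smul_mul, Matrix.mul_smul,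
        smul_smul, Matrix.mul_assoc, ← Matrix.mul_assoc P, hPP, ← Matrix.mul_assoc,
        Complex.star_def, Complex.conj_ofReal, sq]
    rw [sum_congr rfl fun w _ => h w, ← map_sum, ← smul_sum, sum_conj_stabProj hψ hχ hx, smul_smul,
      ← Complex.ofReal_pow, hc]
    have h1 : ((d : ℂ) ^ n) ^ 2 = Nat.card L * Nat.card M := by exact_mod_cast hcard.symm
    have h2 : ((Nat.card M : ℝ) : ℂ) ≠ 0 := by exact_mod_cast hM0
    rw [h1, mul_div_cancel_left₀ _ hL0]
    push_cast at h2 ⊢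
    rw [inv_mul_cancel₀ h2, one_smul, map_one]
  refine ⟨(Φ P).range, ?_, krausCP K, trace_krausCP hK, ?_⟩
  · have := (eq_div_iff hL0).mp hfr
    exact_mod_cast this
  have htr : ∀ w u, ‖LinearMap.trace ℂ (QuditSpace d n) (K w * 𝒲.krausN ω u * Φ P : Op d n)‖ ^ 2 /
      (Module.finrank ℂ (Φ P).range : ℝ) ^ 2 = (Nat.card M : ℝ)⁻¹ *
        ‖∑ v, if v - x w ∈ L then 𝒲.coeffN u v * relPhase ψ (x w) v * χ (v - x w) else 0‖ ^ 2 := by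
    intro w u
    have : LinearMap.trace ℂ (QuditSpace d n) (K w * 𝒲.krausN ω u * Φ P : Op d n) =
        c * Module.finrank ℂ (Φ P).range * ∑ v, if v - x w ∈ L then
          𝒲.coeffN u v * relPhase ψ (x w) v * χ (v - x w) else 0 := by
      rw [𝒲.krausN_eq hω.pow_eq_one, ← map_mul, ← map_mul, trace_toEuclideanCLM,
        Matrix.trace_mul_comm, ← Matrix.mul_assoc, Matrix.mul_smul, ← Matrix.mul_assoc P, hPP,
        Finset.mul_sum, Matrix.trace_sum, mul_sum]
      refine sum_congr rfl fun v _ => ?_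
      rw [Matrix.smul_mul, Matrix.mul_smul, Matrix.mul_assoc, conjTranspose_weyl_mul,
        Matrix.mul_smul, Matrix.trace_smul, Matrix.trace_smul, Matrix.trace_smul,
        trace_stabProj_mul hψ hχ, hfr]
      split_ifs
      · simp only [smul_eq_mul]; ring
      · simp
    rw [this, norm_mul, norm_mul, Complex.norm_real, Complex.norm_natCast, mul_pow, mul_pow,
      Real.norm_eq_abs, sq_abs, hc]
    field_simp
  have h := le_fidelity hp K (𝒲.krausN ω (n := n))
  simp only [htr, ← mul_sum] at h
  exact h

/-- The average fidelity over all twists of one `χ` is at least the probability that the true error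
lies in the decoded coset of `L`. Some twist reaches the average, and `decoding_error_le` bounds the
complementary probability. -/
theorem exists_code (hω : IsPrimitiveRoot ω d) (𝒲 : QDMC d) (hL : L ≤ (symp d n).orthogonal L)
    (hcard : Nat.card L * Nat.card ((symp d n).orthogonal L) = (d ^ n) ^ 2) :
    ∃ Q : Submodule ℂ (QuditSpace d n), Module.finrank ℂ Q * Nat.card L = d ^ n ∧
      ∃ 𝓡 : CompletelyPositiveMap (Op d n) (Op d n),
        (∀ S : Op d n, LinearMap.trace ℂ (QuditSpace d n) (𝓡 S : Op d n) =
          LinearMap.trace ℂ (QuditSpace d n) S) ∧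
        1 - fidelity Q (fun S => 𝓡 (𝒲.apply ω n S)) ≤
          ∑ z, if z ∈ (symp d n).orthogonal L ∧ z ∉ L then ∏ i, 𝒲.bhatt (z i) else 0 := by
  set ψ := AddChar.zmodChar d hω.pow_eq_one
  have hψ : Function.Injective ψ := zmodChar_injective hω
  set M := (symp d n).orthogonal L
  have hM0 : (0 : ℝ) < Nat.card M := Nat.cast_pos.mpr Nat.card_pos
  obtain ⟨x, hx, hmax⟩ := exists_max_coset M (𝒲.WN (n := n))
  obtain ⟨χ, hχ⟩ := exists_isTwistedChar ψ hL
  choose Q hQ 𝓡 htr hF using fun t => exists_stabilizer_code hω 𝒲 hcard hx (hχ.twist t)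
  have havg : ∀ w u, ∑ t, ‖∑ v, if v - x w ∈ L then 𝒲.coeffN u v * relPhase ψ (x w) v *
      (ψ (symp d n t (v - x w)) * χ (v - x w)) else 0‖ ^ 2 =
      ((d : ℝ) ^ n) ^ 2 * ∑ v, if v - x w ∈ L then ‖𝒲.coeffN u v‖ ^ 2 else 0 := by
    intro w u
    have h := sum_norm_sq_symp hψ fun v => if v ∈ L then 𝒲.coeffN u (v + x w) *
      relPhase ψ (x w) (v + x w) * χ v else 0
    -- Translating by `x w` puts the sum in the form required by Parseval; `relPhase` and `χ` have
    -- modulus one and drop out.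
    simp only [← Equiv.sum_comp (Equiv.addRight (x w)) (fun v => ite (v - x w ∈ L) _ _)]
    simp only [Equiv.coe_addRight, add_sub_cancel_right]
    calc _ = _ := sum_congr rfl fun t _ => by
          congr 2
          refine sum_congr rfl fun v _ => ?_
          rw [ite_mul, zero_mul]
          split_ifs <;> ring
      _ = _ := h
      _ = _ := by
          congr 1
          refine sum_congr rfl fun v _ => ?_
          split_ifs with hv
          · rw [norm_mul, norm_mul, norm_relPhase, hχ.norm v hv, mul_one, mul_one]
          · simp
  have hsum : ∑ _t : Fin n → Alphabet d, ((Nat.card M : ℝ)⁻¹ *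
      ∑ w, ∑ v, if v - x w ∈ L then 𝒲.WN v else 0) ≤
      ∑ t, fidelity (Q t) fun S => 𝓡 t (𝒲.apply ω n S) := by
    refine le_trans (le_of_eq ?_) (sum_le_sum fun t _ => hF t)
    have hV : (Fintype.card (Fin n → Alphabet d) : ℝ) = ((d : ℝ) ^ n) ^ 2 := by
      simp only [Fintype.card_pi, Fintype.card_prod, ZMod.card, prod_const, card_univ,
        Fintype.card_fin]
      push_cast
      ring
    rw [sum_const, card_univ, nsmul_eq_mul, hV, mul_left_comm, mul_sum]
    conv_rhs => rw [← mul_sum, sum_comm]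
    congr 1
    refine sum_congr rfl fun w _ => ?_
    conv_rhs => rw [sum_comm, sum_congr rfl fun u _ => havg w u, ← mul_sum, sum_comm]
    congr 1
    refine sum_congr rfl fun v _ => ?_
    split_ifs
    · exact (𝒲.sum_norm_coeffN v).symm
    · simp
  obtain ⟨t, -, ht⟩ := exists_le_of_sum_le univ_nonempty hsum
  refine ⟨Q t, hQ t, 𝓡 t, htr t, ?_⟩
  have hdec := decoding_error_le 𝒲.WN_nonneg hx hmax hL
  rw [𝒲.sum_WN, mul_one, sub_le_iff_le_add', ← sub_le_iff_le_add] at hdec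
  simp only [𝒲.prod_bhatt]
  refine (sub_le_sub_left ht 1).trans ?_
  rw [← mul_le_mul_iff_right₀ hM0, mul_sub, mul_one, mul_inv_cancel_left₀ hM0.ne']
  linarith

end Code

open Module

/-! ### Choosing the isotropic subspace -/

section Isotropic

variable {d n : ℕ} [Fact d.Prime]

theorem card_eq_prime_pow_finrank (L : Submodule (ZMod d) (Fin n → Alphabet d)) :
    Nat.card L = d ^ finrank (ZMod d) L := by
  rw [Nat.card_eq_fintype_card, Module.card_eq_pow_finrank (K := ZMod d), ZMod.card]

theorem finrank_symp_orthogonal (L : Submodule (ZMod d) (Fin n → Alphabet d)) :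
    finrank (ZMod d) ((symp d n).orthogonal L) = 2 * n - finrank (ZMod d) L := by
  rw [LinearMap.BilinForm.finrank_orthogonal symp_nondegenerate,
    Module.finrank_pi_fintype]
  simp [mul_comm]

theorem mem_orthogonal_sup_span {L : Submodule (ZMod d) (Fin n → Alphabet d)}
    {v z : Fin n → Alphabet d} : z ∈ (symp d n).orthogonal (L ⊔ Submodule.span (ZMod d) {v}) ↔
      z ∈ (symp d n).orthogonal L ∧ symp d n v z = 0 := by
  constructor
  · intro h
    exact ⟨LinearMap.BilinForm.orthogonal_le le_sup_left h,
      h v (Submodule.mem_sup_right (Submodule.mem_span_singleton_self v))⟩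
  · rintro ⟨h1, h2⟩ w hw
    obtain ⟨l, hl, m, hm, rfl⟩ := Submodule.mem_sup.mp hw
    obtain ⟨c, rfl⟩ := Submodule.mem_span_singleton.mp hm
    have h3 : symp d n l z = 0 := h1 l hl
    change symp d n (l + c • v) z = 0
    rw [map_add, map_smul, LinearMap.add_apply, LinearMap.smul_apply, h2, h3, smul_zero, add_zero]

theorem card_filter_mem_and_notMem {L M : Submodule (ZMod d) (Fin n → Alphabet d)} (h : L ≤ M) :
    #{v | v ∈ M ∧ v ∉ L} = Nat.card M - Nat.card L := by
  rw [Nat.card_eq_fintype_card, Nat.card_eq_fintype_card, Fintype.card_subtype,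
    Fintype.card_subtype, ← card_sdiff_of_subset (monotone_filter_right _ fun v _ hv => h hv)]
  congr 1
  ext v
  simp

/-- Adding a vector to an isotropic subspace `L` so that the sum of `φ` over `Lᗮ \ L` drops by the
factor `d`. -/
theorem exists_extend_isotropic {φ : (Fin n → Alphabet d) → ℝ} (hφ : ∀ z, 0 ≤ φ z)
    {L : Submodule (ZMod d) (Fin n → Alphabet d)} (hL : L ≤ (symp d n).orthogonal L)
    (hn : finrank (ZMod d) L < n) : ∃ L' : Submodule (ZMod d) (Fin n → Alphabet d),
      L' ≤ (symp d n).orthogonal L' ∧ finrank (ZMod d) L' = finrank (ZMod d) L + 1 ∧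
      d * ∑ z, (if z ∈ (symp d n).orthogonal L' ∧ z ∉ L' then φ z else 0) ≤
        ∑ z, if z ∈ (symp d n).orthogonal L ∧ z ∉ L then φ z else 0 := by
  set j := finrank (ZMod d) L
  set M := (symp d n).orthogonal L
  have hd : 1 < d := (Fact.out : d.Prime).one_lt
  have hcM : Nat.card M = d ^ (2 * n - j) := by
    rw [card_eq_prime_pow_finrank, finrank_symp_orthogonal]
  have hcL : Nat.card L = d ^ j := card_eq_prime_pow_finrank L
  set S : Finset (Fin n → Alphabet d) := {v | v ∈ M ∧ v ∉ L} with hS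
  have hcS : #S = d ^ (2 * n - j) - d ^ j := by rw [card_filter_mem_and_notMem hL, hcM, hcL]
  have hSne : S.Nonempty := by
    rw [← card_pos, hcS]
    exact Nat.sub_pos_of_lt (Nat.pow_lt_pow_right hd (by omega))
  -- The candidates `v` orthogonal to `z` form `(L + ⟨z⟩)ᗮ \ L`, of size `d ^ (2n - j - 1) - d ^ j`.
  -- So `z` survives for at most a fraction `1 / d` of them, and averaging over `v ∈ S` yields a
  -- good one.
  have hcount : ∀ z ∈ S, d * #{v | (v ∈ M ∧ v ∉ L) ∧ symp d n z v = 0} ≤ #S := by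
    intro z hz
    obtain ⟨hzM, hzL⟩ := (mem_filter.mp hz).2
    have hle : L ≤ (symp d n).orthogonal (L ⊔ Submodule.span (ZMod d) {z}) := fun l hl =>
      mem_orthogonal_sup_span.mpr ⟨hL hl, by
        have : symp d n l z = 0 := hzM l hl
        rw [symp_swap, this, neg_zero]⟩
    have hset : ({v | (v ∈ M ∧ v ∉ L) ∧ symp d n z v = 0} : Finset (Fin n → Alphabet d)) =
        ({v | v ∈ (symp d n).orthogonal (L ⊔ Submodule.span (ZMod d) {z}) ∧ v ∉ L} :
          Finset (Fin n → Alphabet d)) := by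
      ext v
      simp only [mem_filter, mem_univ, true_and, mem_orthogonal_sup_span]
      tauto
    rw [hset, card_filter_mem_and_notMem hle, card_eq_prime_pow_finrank, finrank_symp_orthogonal,
      Submodule.finrank_sup_span_singleton hzL, hcS, hcL, Nat.mul_sub, ← pow_succ',
      show 2 * n - (finrank (ZMod d) L + 1) + 1 = 2 * n - j by omega]
    exact Nat.sub_le_sub_left (Nat.le_mul_of_pos_left _ (by omega)) _
  have hsum : ∑ v ∈ S, d * ∑ z, (if (z ∈ M ∧ z ∉ L) ∧ symp d n z v = 0 then φ z else 0) ≤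
      ∑ _v ∈ S, ∑ z, if z ∈ M ∧ z ∉ L then φ z else 0 := by
    rw [← mul_sum, sum_comm, mul_sum, sum_const, smul_sum]
    refine sum_le_sum fun z _ => ?_
    by_cases hz : z ∈ M ∧ z ∉ L
    · have h1 : ∑ v ∈ S, (if (z ∈ M ∧ z ∉ L) ∧ symp d n z v = 0 then φ z else 0) =
          #{v | (v ∈ M ∧ v ∉ L) ∧ symp d n z v = 0} * φ z := by
        rw [hS, sum_filter, ← nsmul_eq_mul, ← sum_const, sum_filter]
        refine sum_congr rfl fun v _ => ?_
        simp only [hz.1, hz.2, not_false_eq_true, and_self, true_and]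
        split_ifs <;> tauto
      rw [h1, if_pos hz, nsmul_eq_mul, ← mul_assoc]
      refine mul_le_mul_of_nonneg_right ?_ (hφ z)
      exact_mod_cast hcount z (mem_filter.mpr ⟨mem_univ _, hz⟩)
    · simp [hz]
  obtain ⟨v, hv, hle⟩ := exists_le_of_sum_le hSne hsum
  obtain ⟨hvM, hvL⟩ := (mem_filter.mp hv).2
  refine ⟨L ⊔ Submodule.span (ZMod d) {v}, ?_, Submodule.finrank_sup_span_singleton hvL, ?_⟩
  · refine sup_le (fun l hl => mem_orthogonal_sup_span.mpr ⟨hL hl, ?_⟩) ?_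
    · have : symp d n l v = 0 := hvM l hl
      rw [symp_swap, this, neg_zero]
    · rw [Submodule.span_singleton_le_iff_mem]
      exact mem_orthogonal_sup_span.mpr ⟨hvM, symp_isAlt v⟩
  · refine le_trans ?_ hle
    refine mul_le_mul_of_nonneg_left (sum_le_sum fun z _ => ?_) (Nat.cast_nonneg d)
    by_cases hz : z ∈ (symp d n).orthogonal (L ⊔ Submodule.span (ZMod d) {v}) ∧
        z ∉ L ⊔ Submodule.span (ZMod d) {v}
    · obtain ⟨h1, h2⟩ := mem_orthogonal_sup_span.mp hz.1
      rw [if_pos hz, if_pos ⟨⟨h1, fun h => hz.2 (Submodule.mem_sup_left h)⟩, by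
        rw [symp_swap, h2, neg_zero]⟩]
    · rw [if_neg hz]
      split_ifs
      exacts [hφ z, le_rfl]

theorem exists_isotropic {φ : (Fin n → Alphabet d) → ℝ} (hφ : ∀ z, 0 ≤ φ z) {j : ℕ} (hj : j ≤ n) :
    ∃ L : Submodule (ZMod d) (Fin n → Alphabet d),
      L ≤ (symp d n).orthogonal L ∧ finrank (ZMod d) L = j ∧
      d ^ j * ∑ z, (if z ∈ (symp d n).orthogonal L ∧ z ∉ L then φ z else 0) ≤ ∑ z, φ z := by
  induction j with
  | zero =>
    refine ⟨⊥, bot_le, finrank_bot _ _, ?_⟩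
    rw [pow_zero, one_mul]
    refine sum_le_sum fun z _ => ?_
    split_ifs
    exacts [le_rfl, hφ z]
  | succ j ih =>
    obtain ⟨L, hL, hf, hs⟩ := ih (by omega)
    obtain ⟨L', hL', hf', hs'⟩ := exists_extend_isotropic hφ hL (by omega)
    refine ⟨L', hL', by omega, le_trans ?_ hs⟩
    rw [pow_succ, mul_assoc]
    exact mul_le_mul_of_nonneg_left hs' (by positivity)

theorem card_mul_card_orthogonal {L : Submodule (ZMod d) (Fin n → Alphabet d)}
    (h : finrank (ZMod d) L ≤ n) :
    Nat.card L * Nat.card ((symp d n).orthogonal L) = (d ^ n) ^ 2 := by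
  rw [card_eq_prime_pow_finrank, card_eq_prime_pow_finrank, finrank_symp_orthogonal, ← pow_add,
    ← pow_mul]
  congr 1
  omega

end Isotropic

open Filter Topology

/-! ### The method of types -/

section Types

variable {d n : ℕ} [NeZero d]

/-- The type (empirical distribution) of a word. -/
def empirical (z : Fin n → Alphabet d) (x : Alphabet d) : ℝ := #{i | z i = x} / n

theorem sum_comp_eq_empirical (hn : n ≠ 0) (z : Fin n → Alphabet d) (g : Alphabet d → ℝ) :
    ∑ i, g (z i) = n * ∑ x, empirical z x * g x := by
  rw [← sum_fiberwise (g := z), mul_sum]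
  refine sum_congr rfl fun x _ => ?_
  rw [sum_congr rfl fun i hi => by rw [(mem_filter.mp hi).2], sum_const, nsmul_eq_mul, empirical]
  field_simp

theorem empirical_mem_stdSimplex (hn : n ≠ 0) (z : Fin n → Alphabet d) :
    empirical z ∈ stdSimplex ℝ (Alphabet d) := by
  refine ⟨fun x => by unfold empirical; positivity, ?_⟩
  have h := sum_comp_eq_empirical hn z fun _ => 1
  simp only [sum_const, card_univ, Fintype.card_fin, nsmul_eq_mul, mul_one] at h
  have hn' : (n : ℝ) ≠ 0 := Nat.cast_ne_zero.mpr hn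
  exact (mul_left_cancel₀ hn' (by rw [mul_one]; exact h)).symm

theorem empirical_pos (z : Fin n → Alphabet d) (i : Fin n) : 0 < empirical z (z i) := by
  have h1 : 0 < #{j | z j = z i} := card_pos.mpr ⟨i, by simp⟩
  have h2 : 0 < n := i.pos
  unfold empirical
  positivity

/-- The probability of a word under its own type. -/
def typeProb (z : Fin n → Alphabet d) : ℝ := ∏ i, empirical z (z i)

theorem typeProb_pos (z : Fin n → Alphabet d) : 0 < typeProb z :=
  prod_pos fun i _ => empirical_pos z i

theorem logb_typeProb (hn : n ≠ 0) (z : Fin n → Alphabet d) :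
    Real.logb d (typeProb z) = -(n * entropy (empirical z)) := by
  rw [typeProb, Real.logb_prod _ _ (fun i _ => (empirical_pos z i).ne'),
    sum_comp_eq_empirical hn z fun x => Real.logb d (empirical z x), entropy, mul_neg, neg_neg]

/-- There are at most `(n + 1) ^ (d * d)` types, and the words of one type have total probability at
most one under the product of that type. -/
theorem sum_typeProb_le (hn : n ≠ 0) :
    ∑ z : Fin n → Alphabet d, typeProb z ≤ ((n : ℝ) + 1) ^ (d * d) := by
  let cnt : (Fin n → Alphabet d) → Alphabet d → Fin (n + 1) := fun z x =>
    ⟨#{i | z i = x}, Nat.lt_succ_of_le ((card_le_univ _).trans_eq (Fintype.card_fin n))⟩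
  have hcard : (Fintype.card (Alphabet d → Fin (n + 1)) : ℝ) = ((n : ℝ) + 1) ^ (d * d) := by
    simp [Fintype.card_pi, Fintype.card_prod, ZMod.card]
  rw [← sum_fiberwise (g := cnt), ← hcard, ← mul_one (Fintype.card _ : ℝ), ← nsmul_eq_mul,
    ← card_univ, ← sum_const]
  refine sum_le_sum fun f _ => ?_
  rcases (univ.filter fun z => cnt z = f).eq_empty_or_nonempty with h | ⟨z₀, hz₀⟩
  · rw [h, sum_empty]; exact zero_le_one
  have hemp : ∀ z, cnt z = f → empirical z = empirical z₀ := fun z hz => by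
    ext x
    have := congrFun (hz.trans (mem_filter.mp hz₀).2.symm) x
    rw [empirical, empirical, show #{i | z i = x} = #{i | z₀ i = x} from congrArg Fin.val this]
  calc ∑ z with cnt z = f, typeProb z = ∑ z with cnt z = f, ∏ i, empirical z₀ (z i) :=
        sum_congr rfl fun z hz => by rw [typeProb, hemp z (mem_filter.mp hz).2]
    _ ≤ ∑ z : Fin n → Alphabet d, ∏ i, empirical z₀ (z i) :=
        sum_le_sum_of_subset_of_nonneg (filter_subset _ _) fun z _ _ =>
          prod_nonneg fun i _ => (empirical_mem_stdSimplex hn z₀).1 _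
    _ = 1 := by
        have := Finset.prod_univ_sum (fun _ : Fin n => (univ : Finset (Alphabet d)))
          (fun _ x => empirical z₀ x)
        rw [Fintype.piFinset_univ] at this
        rw [← this, (empirical_mem_stdSimplex hn z₀).2, prod_const_one]

end Types

/-! ### The expurgation exponent as a minimum -/

section Exponent

variable {d : ℕ} [NeZero d]

theorem continuous_entropy : Continuous (entropy (d := d)) := by
  unfold entropy
  simp only [Real.logb, ← mul_div_assoc]
  exact (continuous_finsetSum _ fun x _ =>
    (Real.continuous_mul_log.comp (continuous_apply x)).div_const _).neg

/-- The finite values of the objective function of the expurgation exponent. -/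
def realObjective (𝒲 : QDMC d) (R : ℝ) (P : Alphabet d → ℝ) : ℝ :=
  -(∑ x, P x * Real.logb d (𝒲.bhatt x)) - (R + entropy P - 1)

/-- Continuity holds everywhere because `Real.logb d 0 = 0`; the function is the true objective only
on `finiteSupport`. -/
theorem continuous_realObjective (𝒲 : QDMC d) (R : ℝ) : Continuous (realObjective 𝒲 R) := by
  unfold realObjective
  have := continuous_entropy (d := d)
  fun_prop

/-- The distributions for which the objective function of the expurgation exponent is finite. -/
def finiteSupport (𝒲 : QDMC d) : Set (Alphabet d → ℝ) :=
  stdSimplex ℝ (Alphabet d) ∩ {P | ∀ x, 𝒲.bhatt x = 0 → P x = 0}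

theorem isCompact_finiteSupport (𝒲 : QDMC d) : IsCompact (finiteSupport 𝒲) := by
  refine (isCompact_stdSimplex ℝ _).inter_right ?_
  simp only [Set.ofPred_forall]
  exact isClosed_iInter fun x => isClosed_iInter fun _ =>
    isClosed_eq (continuous_apply x) continuous_const

theorem weight_eq_top {𝒲 : QDMC d} {x : Alphabet d} (h : 𝒲.bhatt x = 0) : weight 𝒲 x = ⊤ := by
  change -elogb d (𝒲.bhatt x) = ⊤
  rw [elogb, if_pos (le_of_eq h), EReal.neg_bot]

theorem weight_eq_coe {𝒲 : QDMC d} {x : Alphabet d} (h : 𝒲.bhatt x ≠ 0) :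
    weight 𝒲 x = ((-Real.logb d (𝒲.bhatt x) : ℝ) : EReal) := by
  have : ¬ 𝒲.bhatt x ≤ 0 := not_le.mpr (lt_of_le_of_ne (𝒲.bhatt_nonneg x) h.symm)
  change -elogb d (𝒲.bhatt x) = _
  rw [elogb, if_neg this, EReal.coe_neg]

theorem ereal_coe_sum {ι : Type*} (s : Finset ι) (f : ι → ℝ) :
    ((∑ i ∈ s, f i : ℝ) : EReal) = ∑ i ∈ s, (f i : EReal) := by
  induction s using Finset.cons_induction with
  | empty => simp
  | cons a s ha ih => rw [sum_cons, sum_cons, EReal.coe_add, ih]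

theorem objective_eq_coe {𝒲 : QDMC d} {P : Alphabet d → ℝ} (hP : P ∈ finiteSupport 𝒲) (R : ℝ) :
    (∑ x, (P x : EReal) * weight 𝒲 x) - ((R + entropy P - 1 : ℝ) : EReal) =
      (realObjective 𝒲 R P : EReal) := by
  have h : ∀ x, (P x : EReal) * weight 𝒲 x = ((-(P x * Real.logb d (𝒲.bhatt x)) : ℝ) : EReal) := by
    intro x
    by_cases hx : 𝒲.bhatt x = 0
    · rw [hP.2 x hx]; simp
    · rw [weight_eq_coe hx, ← EReal.coe_mul, mul_neg]
  rw [sum_congr rfl fun x _ => h x, ← ereal_coe_sum, sum_neg_distrib, ← EReal.coe_sub]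
  rfl

theorem objective_eq_top {𝒲 : QDMC d} {P : Alphabet d → ℝ}
    (hP : P ∈ stdSimplex ℝ (Alphabet d)) (hP' : P ∉ finiteSupport 𝒲) (R : ℝ) :
    (∑ x, (P x : EReal) * weight 𝒲 x) - ((R + entropy P - 1 : ℝ) : EReal) = ⊤ := by
  obtain ⟨x, hx, hPx⟩ : ∃ x, 𝒲.bhatt x = 0 ∧ P x ≠ 0 := by
    by_contra! h
    exact hP' ⟨hP, h⟩
  have hbot : ∀ y, (P y : EReal) * weight 𝒲 y ≠ ⊥ := fun y => by
    by_cases hy : 𝒲.bhatt y = 0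
    · rw [weight_eq_top hy]
      rcases (hP.1 y).eq_or_lt with h0 | h0
      · rw [← h0]; simp
      · rw [EReal.coe_mul_top_of_pos h0]; simp
    · rw [weight_eq_coe hy, ← EReal.coe_mul]
      exact EReal.coe_ne_bot _
  have hsum : ∀ s : Finset (Alphabet d), ∑ y ∈ s, (P y : EReal) * weight 𝒲 y ≠ ⊥ := fun s => by
    induction s using Finset.cons_induction with
    | empty => simp
    | cons a s ha ih =>
      rw [sum_cons, ne_eq, EReal.add_eq_bot_iff]
      exact not_or.mpr ⟨hbot a, ih⟩
  rw [← add_sum_erase univ _ (mem_univ x), weight_eq_top hx,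
    EReal.coe_mul_top_of_pos ((hP.1 x).lt_of_ne hPx.symm), EReal.top_add_of_ne_bot (hsum _),
    EReal.top_sub_coe]

theorem exists_one_sub_le_entropy {R : ℝ} (hd : 1 < d) (hR : 0 ≤ R) :
    ∃ P ∈ stdSimplex ℝ (Alphabet d), 1 - R ≤ entropy P := by
  have hd' : (1 : ℝ) < d := by exact_mod_cast hd
  have hcard : (Fintype.card (Alphabet d) : ℝ) = (d : ℝ) ^ 2 := by
    rw [Fintype.card_prod, ZMod.card]; push_cast; ring
  refine ⟨fun _ => ((d : ℝ) ^ 2)⁻¹, ⟨fun _ => by positivity, ?_⟩, ?_⟩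
  · rw [sum_const, card_univ, nsmul_eq_mul, hcard]
    exact mul_inv_cancel₀ (by positivity)
  · rw [entropy, sum_const, card_univ, nsmul_eq_mul, hcard, mul_inv_cancel_left₀ (by positivity),
      Real.logb_inv, neg_neg, Real.logb_pow, Real.logb_self_eq_one hd']
    push_cast
    linarith

theorem isLeast_expurgationExponent (𝒲 : QDMC d) {R : ℝ} (hd : 1 < d) (hR : 0 ≤ R) :
    IsLeast (expurgationValues 𝒲 R) (expurgationExponent 𝒲 R) := by
  suffices h : ∃ m, IsLeast (expurgationValues 𝒲 R) m by
    obtain ⟨m, hm⟩ := h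
    rwa [expurgationExponent, hm.isGLB.sInf_eq]
  rcases (finiteSupport 𝒲 ∩ {P | 1 - R ≤ entropy P}).eq_empty_or_nonempty with h | h
  -- Every admissible value is `⊤`. The minimum is still attained because the uniform distribution,
  -- of entropy 2, is admissible.
  · obtain ⟨P, hP, hPH⟩ := exists_one_sub_le_entropy hd hR
    refine ⟨⊤, ⟨P, hP, hPH, (objective_eq_top hP ?_ R).symm⟩, ?_⟩
    · exact fun hf => (h.subset ⟨hf, hPH⟩ : P ∈ (∅ : Set _))
    · rintro _ ⟨P', hP', hPH', rfl⟩
      rw [objective_eq_top hP' fun hf => (h.subset ⟨hf, hPH'⟩ : P' ∈ (∅ : Set _))]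
  · have hc : IsCompact (finiteSupport 𝒲 ∩ {P | 1 - R ≤ entropy P}) :=
      (isCompact_finiteSupport 𝒲).inter_right (isClosed_le continuous_const continuous_entropy)
    obtain ⟨P, hP, hmin⟩ := hc.exists_isMinOn h (continuous_realObjective 𝒲 R).continuousOn
    refine ⟨realObjective 𝒲 R P, ⟨P, hP.1.1, hP.2, (objective_eq_coe hP.1 R).symm⟩, ?_⟩
    rintro _ ⟨P', hP', hPH', rfl⟩
    by_cases hf : P' ∈ finiteSupport 𝒲
    · rw [objective_eq_coe hf]
      exact EReal.coe_le_coe_iff.mpr (hmin ⟨hf, hPH'⟩)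
    · rw [objective_eq_top hP' hf]
      exact le_top

/-- Lower semicontinuity of the expurgation exponent in the entropy constraint. -/
theorem exists_entropy_slack {𝒲 : QDMC d} {R c : ℝ} (hc : (c : EReal) < expurgationExponent 𝒲 R) :
    ∃ δ > 0, ∀ P ∈ finiteSupport 𝒲, 1 - R - δ ≤ entropy P → c < realObjective 𝒲 R P := by
  have hcomp : IsCompact (finiteSupport 𝒲 ∩ {P | realObjective 𝒲 R P ≤ c}) :=
    (isCompact_finiteSupport 𝒲).inter_right
      (isClosed_le (continuous_realObjective 𝒲 R) continuous_const)
  rcases (finiteSupport 𝒲 ∩ {P | realObjective 𝒲 R P ≤ c}).eq_empty_or_nonempty with h | h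
  · refine ⟨1, one_pos, fun P hP _ => ?_⟩
    by_contra! hle
    exact (h.subset ⟨hP, hle⟩ : P ∈ (∅ : Set _))
  -- Among the distributions with objective at most `c`, the largest entropy is attained and lies
  -- strictly below `1 - R`; half the gap serves as `δ`.
  · obtain ⟨P₁, hP₁, hmax⟩ := hcomp.exists_isMaxOn h continuous_entropy.continuousOn
    have hlt : entropy P₁ < 1 - R := by
      by_contra! hge
      have h1 : expurgationExponent 𝒲 R ≤ realObjective 𝒲 R P₁ :=
        sInf_le ⟨P₁, hP₁.1.1, hge, (objective_eq_coe hP₁.1 R).symm⟩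
      exact absurd (hc.trans_le h1) (not_lt.mpr (EReal.coe_le_coe_iff.mpr hP₁.2))
    refine ⟨(1 - R - entropy P₁) / 2, by linarith, fun P hP hPH => ?_⟩
    by_contra! hle
    have : entropy P ≤ entropy P₁ := hmax ⟨hP, hle⟩
    linarith

end Exponent

/-! ### The exponential bound and the limit -/

section Bound

variable {d : ℕ} [Fact d.Prime]

/-- The subexponential factor in the bound on the error probability. -/
def polyFactor (d n : ℕ) : ℝ := d * ((n : ℝ) + 1) ^ (d * d)

theorem polyFactor_pos (n : ℕ) : 0 < polyFactor d n := by
  have : 0 < d := (Fact.out : d.Prime).pos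
  unfold polyFactor
  positivity

theorem tendsto_logb_polyFactor :
    Tendsto (fun n : ℕ => Real.logb d (polyFactor d n) / n) atTop (𝓝 0) := by
  have hd : 1 < d := (Fact.out : d.Prime).one_lt
  have hd' : (1 : ℝ) < d := by exact_mod_cast hd
  have h1 : Tendsto (fun n : ℕ => (1 : ℝ) / n) atTop (𝓝 0) := tendsto_one_div_atTop_nhds_zero_nat
  -- The denominator is `n`, written as a function of `n + 1` to match the logarithm.
  have h2 : Tendsto (fun n : ℕ => Real.log ((n : ℝ) + 1) ^ 1 / (1 * ((n : ℝ) + 1) + -1)) atTop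
      (𝓝 0) :=
    (Real.tendsto_pow_log_div_mul_add_atTop 1 (-1) 1 one_ne_zero).comp
      (tendsto_atTop_add_const_right _ _ tendsto_natCast_atTop_atTop)
  have h3 := h1.add (h2.const_mul ((d * d : ℝ) / Real.log d))
  rw [mul_zero, add_zero] at h3
  refine h3.congr fun n => ?_
  have hn : (0 : ℝ) < (n : ℝ) + 1 := by positivity
  rw [polyFactor, Real.logb_mul (by positivity) (by positivity), Real.logb_self_eq_one hd',
    Real.logb_pow, Real.logb]
  push_cast
  ring

/-- In logarithms, `hz` says that the type of `z` nearly meets the entropy constraint, so its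
objective exceeds `c`; multiplied by `n`, this is the claim. The leading `d` pays for the `-1` in
`hj`. Words containing a letter of infinite weight contribute zero. -/
theorem prod_bhatt_le {𝒲 : QDMC d} {R c δ : ℝ}
    (hδ : ∀ P ∈ finiteSupport 𝒲, 1 - R - δ ≤ entropy P → c < realObjective 𝒲 R P)
    {n j : ℕ} (hn : n ≠ 0) (hj : (n : ℝ) * (1 - R) - 1 ≤ j)
    (hpoly : Real.logb d (polyFactor d n) / n ≤ δ) {z : Fin n → Alphabet d}
    (hz : (d : ℝ) ^ j * typeProb z ≤ ((n : ℝ) + 1) ^ (d * d)) :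
    ∏ i, 𝒲.bhatt (z i) ≤ d * (d : ℝ) ^ (-(n * c)) * ((d : ℝ) ^ j * typeProb z) := by
  have hd : (1 : ℝ) < d := by exact_mod_cast (Fact.out : d.Prime).one_lt
  have hd0 : (0 : ℝ) < d := by linarith
  have hn' : (0 : ℝ) < n := by exact_mod_cast Nat.pos_of_ne_zero hn
  have ht := typeProb_pos z
  by_cases h0 : ∃ i, 𝒲.bhatt (z i) = 0
  · obtain ⟨i, hi⟩ := h0
    rw [prod_eq_zero (mem_univ i) hi]
    positivity
  push Not at h0
  have hsupp : empirical z ∈ finiteSupport 𝒲 := by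
    refine ⟨empirical_mem_stdSimplex hn z, fun x hx => ?_⟩
    rw [empirical, card_eq_zero.mpr, Nat.cast_zero, zero_div]
    rw [filter_eq_empty_iff]
    rintro i - rfl
    exact h0 i hx
  have hlog := Real.logb_le_logb_of_le hd (by positivity) hz
  rw [Real.logb_mul (by positivity) ht.ne', Real.logb_pow, Real.logb_self_eq_one hd,
    logb_typeProb hn] at hlog
  have hpoly' : Real.logb d (polyFactor d n) = 1 + Real.logb d (((n : ℝ) + 1) ^ (d * d)) := by
    rw [polyFactor, Real.logb_mul (by positivity) (by positivity), Real.logb_self_eq_one hd]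
  rw [div_le_iff₀ hn', hpoly'] at hpoly
  have hH : 1 - R - δ ≤ entropy (empirical z) := by
    refine le_of_mul_le_mul_left ?_ hn'
    linarith
  have hobj := mul_lt_mul_of_pos_left (hδ _ hsupp hH) hn'
  have hb : 0 < ∏ i, 𝒲.bhatt (z i) :=
    prod_pos fun i _ => lt_of_le_of_ne (𝒲.bhatt_nonneg _) (h0 i).symm
  rw [← Real.logb_le_logb hd hb (by positivity), Real.logb_prod _ _ (fun i _ => h0 i),
    sum_comp_eq_empirical hn z fun x => Real.logb d (𝒲.bhatt x),
    Real.logb_mul (by positivity) (by positivity), Real.logb_mul (by positivity) (by positivity),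
    Real.logb_mul (by positivity) ht.ne', Real.logb_pow, Real.logb_self_eq_one hd,
    Real.logb_rpow hd0 hd.ne', logb_typeProb hn]
  rw [realObjective] at hobj
  linarith

theorem exists_good_code {ω : ℂ} (hω : IsPrimitiveRoot ω d) {𝒲 : QDMC d} {R c δ : ℝ}
    (hR₀ : 0 ≤ R) (hR₁ : R ≤ 1)
    (hδ : ∀ P ∈ finiteSupport 𝒲, 1 - R - δ ≤ entropy P → c < realObjective 𝒲 R P)
    {n : ℕ} (hn : n ≠ 0) (hpoly : Real.logb d (polyFactor d n) / n ≤ δ) :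
    ∃ Q : Submodule ℂ (QuditSpace d n), Q ≠ ⊥ ∧ R ≤ rate Q ∧
      ∃ 𝓡 : CompletelyPositiveMap (Op d n) (Op d n),
        (∀ S : Op d n, LinearMap.trace ℂ (QuditSpace d n) (𝓡 S : Op d n) =
          LinearMap.trace ℂ (QuditSpace d n) S) ∧
        1 - fidelity Q (fun S => 𝓡 (𝒲.apply ω n S)) ≤
          polyFactor d n * (d : ℝ) ^ (-(n * c)) := by
  have hd : (1 : ℝ) < d := by exact_mod_cast (Fact.out : d.Prime).one_lt
  have hn' : (0 : ℝ) < n := by exact_mod_cast Nat.pos_of_ne_zero hn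
  -- Rounding up keeps the rate at least `R` and costs less than one dimension, whence the factor
  -- `d` in `polyFactor`.
  set k := ⌈n * R⌉₊
  have hkn : k ≤ n := Nat.ceil_le.mpr (mul_le_of_le_one_right hn'.le hR₁)
  have hk1 : n * R ≤ k := Nat.le_ceil _
  have hk2 : (k : ℝ) < n * R + 1 := Nat.ceil_lt_add_one (by positivity)
  obtain ⟨L, hL, hfr, hsum⟩ := exists_isotropic (d := d) (n := n)
    (fun z => (typeProb_pos z).le) (Nat.sub_le n k)
  obtain ⟨Q, hQ, 𝓡, htr, hF⟩ := exists_code hω 𝒲 hL (card_mul_card_orthogonal (by omega))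
  have hQ' : finrank ℂ Q = d ^ k := by
    rw [card_eq_prime_pow_finrank, hfr] at hQ
    have : 0 < d ^ (n - k) := pow_pos (Fact.out : d.Prime).pos _
    refine Nat.eq_of_mul_eq_mul_right this (hQ.trans ?_)
    rw [← pow_add, Nat.add_sub_cancel' hkn]
  refine ⟨Q, ?_, ?_, 𝓡, htr, hF.trans ?_⟩
  · rintro rfl
    rw [finrank_bot] at hQ'
    exact (pow_pos (Fact.out : d.Prime).pos k).ne hQ'
  · rw [rate, hQ', Nat.cast_pow, Real.logb_pow, Real.logb_self_eq_one hd, mul_one,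
      le_div_iff₀ hn', mul_comm]
    exact hk1
  have hj : (n : ℝ) * (1 - R) - 1 ≤ (n - k : ℕ) := by
    rw [Nat.cast_sub hkn]
    linarith
  have hle := hsum.trans (sum_typeProb_le hn)
  have hterm : ∀ z : Fin n → Alphabet d,
      (if z ∈ (symp d n).orthogonal L ∧ z ∉ L then ∏ i, 𝒲.bhatt (z i) else 0) ≤
      d * (d : ℝ) ^ (-(n * c)) * ((d : ℝ) ^ (n - k) *
        if z ∈ (symp d n).orthogonal L ∧ z ∉ L then typeProb z else 0) := by
    intro z
    split_ifs with hz
    -- Expurgation: a single term is at most the whole sum over `Lᗮ \ L`, so no word there has a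
    -- type of low entropy.
    · refine prod_bhatt_le hδ hn hj hpoly (le_trans ?_ hle)
      refine mul_le_mul_of_nonneg_left ?_ (by positivity)
      refine le_trans (le_of_eq (if_pos hz).symm)
        (single_le_sum (f := fun z => if z ∈ (symp d n).orthogonal L ∧ z ∉ L then typeProb z else 0)
          (fun z _ => ?_) (mem_univ z))
      split_ifs
      exacts [(typeProb_pos z).le, le_rfl]
    · simp
  refine (sum_le_sum fun z _ => hterm z).trans ?_
  rw [← mul_sum, ← mul_sum, polyFactor, mul_right_comm (d : ℝ)]
  gcongr

theorem le_neg_mul_elogb {n : ℕ} (hn : n ≠ 0) {c y : ℝ}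
    (hy : y ≤ polyFactor d n * (d : ℝ) ^ (-(n * c))) :
    ((c - Real.logb d (polyFactor d n) / n : ℝ) : EReal) ≤
      -(((1 / (n : ℝ) : ℝ) : EReal) * elogb d y) := by
  have hd : (1 : ℝ) < d := by exact_mod_cast (Fact.out : d.Prime).one_lt
  have hn' : (0 : ℝ) < n := by exact_mod_cast Nat.pos_of_ne_zero hn
  rw [elogb]
  split_ifs with h
  · rw [EReal.coe_mul_bot_of_pos (by positivity), EReal.neg_bot]
    exact le_top
  · push Not at h
    have hp := polyFactor_pos (d := d) n
    have := Real.logb_le_logb_of_le hd h hy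
    rw [Real.logb_mul hp.ne' (by positivity), Real.logb_rpow (by linarith) hd.ne'] at this
    rw [← EReal.coe_mul, ← EReal.coe_neg, EReal.coe_le_coe_iff]
    have h2 := div_le_div_of_nonneg_right this hn'.le
    rw [add_div, neg_div, mul_div_cancel_left₀ _ hn'.ne'] at h2
    rw [one_div_mul_eq_div]
    linarith

theorem expurgationExponent_le_reliability {ω : ℂ} (hω : IsPrimitiveRoot ω d) (𝒲 : QDMC d)
    {R : ℝ} (hR₀ : 0 ≤ R) (hR₁ : R ≤ 1) :
    expurgationExponent 𝒲 R ≤ reliability 𝒲 ω R := by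
  rw [← EReal.ge_of_forall_gt_iff_ge]
  intro c hc
  -- The gap `c' - c` absorbs the polynomial factor for large `n`.
  obtain ⟨c', hcc', hc'⟩ := EReal.lt_iff_exists_real_btwn.mp hc
  rw [EReal.coe_lt_coe_iff] at hcc'
  obtain ⟨δ, hδ, h⟩ := exists_entropy_slack hc'
  refine le_liminf_of_le (by isBoundedDefault) ?_
  filter_upwards [eventually_ne_atTop 0,
    (tendsto_logb_polyFactor (d := d)).eventually (gt_mem_nhds (lt_min hδ (sub_pos.mpr hcc')))]
    with n hn hsmall
  obtain ⟨Q, hQ, hrate, 𝓡, htr, hF⟩ :=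
    exists_good_code hω hR₀ hR₁ h hn (hsmall.le.trans (min_le_left _ _))
  have h1 : (c : EReal) ≤ ((c' - Real.logb d (polyFactor d n) / n : ℝ) : EReal) := by
    rw [EReal.coe_le_coe_iff]
    linarith [hsmall.trans_le (min_le_right δ (c' - c))]
  refine (h1.trans (le_neg_mul_elogb hn hF)).trans ?_
  rw [errorExponent]
  exact le_iSup_of_le Q <| le_iSup_of_le hQ <| le_iSup_of_le hrate <| le_iSup_of_le 𝓡 <|
    le_iSup_of_le htr le_rfl

end Bound

end QuantumChannel

end

theorem theorem6 (d : ℕ) [Fact d.Prime] (ω : ℂ) (hω : IsPrimitiveRoot ω d)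
    (𝒲 : QuantumChannel.QDMC d) (R : ℝ) (hR₀ : 0 ≤ R) (hR₁ : R ≤ 1) :
    IsLeast (QuantumChannel.expurgationValues 𝒲 R) (QuantumChannel.expurgationExponent 𝒲 R) ∧
      QuantumChannel.expurgationExponent 𝒲 R ≤ QuantumChannel.reliability 𝒲 ω R :=
  ⟨QuantumChannel.isLeast_expurgationExponent 𝒲 (Fact.out : d.Prime).one_lt hR₀,
    QuantumChannel.expurgationExponent_le_reliability hω 𝒲 hR₀ hR₁⟩
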